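/- Setting. Let $n,p\ge 1$ be integers, $q\in[0,1]$, $K>0$, and let $X_1,\dots,X_n$ be i.i.d. random vectors in $\mathbb R^p$ with covariance matrix $\Sigma=\lambda_1\theta_1\theta_1^T+\lambda_2\Sigma_0$, where $\lambda_1>\lambda_2\ge 0$, $\|\theta_1\|_2=1$, $\Sigma_0\succeq 0$, $\Sigma_0\theta_1=0$ and $\Sigma_0$ has spectral norm $1$. For $R>0$ write $\mathbb B_q^p(R)=\{\theta\in\mathbb R^p:\sum_j|\theta_j|^q\le R\}$ if $q>0$, and $\mathbb B_0^p(R)$ for the set of vectors with at most $R$ nonzero entries. Let $R_q$ be a real number, put $\bar R_q=R_q-1$, $\sigma^2=\lambda_1\lambda_2/(\lambda_1-\lambda_2)^2$ and $\tilde\sigma=\lambda_1/(\lambda_1-\lambda_2)$, and assume: (i) $\theta_1\in\mathbb B_q^p(R_q)$; (ii) for some $\alpha\in(0,1]$ and $\kappa>0$, $$\bar R_q\le \kappa^q(p-1)^{1-\alpha}\,\bar R_q^{\frac{2\alpha}{2-q}}\Big[\frac{\sigma^2}{n}\log\frac{p-1}{\bar R_q^{2/(2-q)}}\Big]^{q/2}\quad\text{and}\quad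 1\le\bar R_q\le e^{-1}(p-1)^{1-q/2};$$ (iii) there are $\mu\in\mathbb R^p$ and i.i.d. random vectors $Z_1,\dots,Z_n$ in $\mathbb R^p$ with $\mathbb E Z_i=0$, $\mathbb E Z_iZ_i^T=I_p$, $X_i=\mu+\Sigma^{1/2}Z_i$ and $\sup_{\|x\|_2=1}\|\langle Z_i,x\rangle\|_{\psi_2}\le K$, where $\|Y\|_{\psi_2}=\inf\{t>0:\mathbb E\exp(|Y/t|^2)\le 2\}$. Let $S=\frac1n\sum_{i=1}^nX_iX_i^T-\bar X\bar X^T$ with $\bar X=\frac1n\sum_{i=1}^n X_i$, let $\hat\theta_1$ be a (measurable) maximizer of $b\mapsto b^TSb$ over $\{b\in\mathbb R^p:\|b\|_2=1\}\cap\mathbb B_q^p(R_q)$, and let $\epsilon=\|\hat\theta_1\hat\theta_1^T-\theta_1\theta_1^T\|_F$ (Frobenius norm). Theorem (upper bound for sparse PCA). For every $K>0$ there is a constant $c>0$, depending only on $K$, such that in every such setting the following hold. 1. If $q\in(0,1)$, then $\displaystyle \mathbb E\,\epsilon^2\le c\,\min\Big\{1,\;R_q^2\Big[\frac{\tilde\sigma^2}{n}\log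 p\Big]^{1-\frac q2}\Big\}.$ 2. If $q=1$, then $\displaystyle \mathbb E\,\epsilon^2\le c\,\min\Big\{1,\;R_1\Big[\frac{\tilde\sigma^2}{n}\log(p/R_1^2)\Big]^{\frac12}\Big\}.$ 3. If $q=0$, then $\displaystyle (\mathbb E\,\epsilon)^2\le c\,\min\Big\{1,\;R_0\,\frac{\tilde\sigma^2}{n}\log(p/R_0)\Big\}.$ -/

import Mathlib

open MeasureTheory ProbabilityTheory
open scoped ENNReal

universe u

namespace SparsePCA

noncomputable section

/-- `ℝ^p` with its Euclidean structure. -/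
abbrev Vec (p : ℕ) : Type := EuclideanSpace ℝ (Fin p)

/-- The `ℓ_q` ball `{θ ∈ ℝ^p : ∑ |θ_j|^q ≤ R}` for `q > 0`; for `q = 0` the set of vectors with at
most `R` nonzero entries. -/
def lqBall (q : ℝ) (p : ℕ) (R : ℝ) : Set (Vec p) :=
  {θ | (∑ j, if q = 0 then (if θ j ≠ 0 then (1 : ℝ) else 0) else |θ j| ^ q) ≤ R}

/-- The rank-one matrix `θ θᵀ`. -/
def outer {p : ℕ} (θ : Vec p) : Matrix (Fin p) (Fin p) ℝ :=
  Matrix.of fun j k => θ j * θ k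

/-- The Frobenius norm of a real matrix. -/
def frobNorm {p : ℕ} (A : Matrix (Fin p) (Fin p) ℝ) : ℝ :=
  √(∑ j, ∑ k, A j k ^ 2)

/-- The quadratic form `bᵀ A b`. -/
def quadForm {p : ℕ} (A : Matrix (Fin p) (Fin p) ℝ) (b : Vec p) : ℝ :=
  ∑ j, ∑ k, b j * A j k * b k

/-- The spectral norm of a real matrix: its operator norm on Euclidean space. -/
def spectralNorm {p : ℕ} (A : Matrix (Fin p) (Fin p) ℝ) : ℝ :=
  ‖Matrix.toEuclideanCLM (n := Fin p) (𝕜 := ℝ) A‖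

/-- The sample mean. -/
def sampleMean {n p : ℕ} (x : Fin n → Vec p) : Vec p :=
  (n : ℝ)⁻¹ • ∑ i, x i

/-- The sample covariance matrix `S = n⁻¹ ∑ x_i x_iᵀ - x̄ x̄ᵀ`. -/
def sampleCov {n p : ℕ} (x : Fin n → Vec p) : Matrix (Fin p) (Fin p) ℝ :=
  (n : ℝ)⁻¹ • ∑ i, outer (x i) - outer (sampleMean x)

/-- `b` solves the `ℓ_q`-constrained PCA problem for the data `x`: it maximizes `bᵀ S b` over the
unit sphere intersected with the `ℓ_q` ball of radius `R`. -/
def IsConstrainedPCA {n p : ℕ} (q R : ℝ) (x : Fin n → Vec p) (b : Vec p) : Prop :=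
  b ∈ Metric.sphere (0 : Vec p) 1 ∩ lqBall q p R ∧
    IsMaxOn (quadForm (sampleCov x)) (Metric.sphere (0 : Vec p) 1 ∩ lqBall q p R) b

/-- `Sig = λ₁ θ₁ θ₁ᵀ + λ₂ Sig₀` with `λ₁ > λ₂ ≥ 0`, `θ₁` a unit vector, `Sig₀` positive semidefinite
of spectral norm one and `Sig₀ θ₁ = 0`. -/
def IsSpiked {p : ℕ} (Sig : Matrix (Fin p) (Fin p) ℝ) (lam₁ lam₂ : ℝ) (θ₁ : Vec p) : Prop :=
  0 ≤ lam₂ ∧ lam₂ < lam₁ ∧ θ₁ ∈ Metric.sphere (0 : Vec p) 1 ∧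
    ∃ Sig₀ : Matrix (Fin p) (Fin p) ℝ,
      Sig₀.PosSemidef ∧ Sig₀.mulVec θ₁ = 0 ∧ spectralNorm Sig₀ = 1 ∧
        Sig = lam₁ • outer θ₁ + lam₂ • Sig₀

/-- The effective noise `σ² = λ₁ λ₂ / (λ₁ - λ₂)²`. -/
def sigmaSq (lam₁ lam₂ : ℝ) : ℝ := lam₁ * lam₂ / (lam₁ - lam₂) ^ 2

/-- The condition on the reduced radius `Rbar = R - 1`. -/
def RadiusCondition (q : ℝ) (n p : ℕ) (lam₁ lam₂ Rbar α κ : ℝ) : Prop :=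
  Rbar ≤ κ ^ q * ((p : ℝ) - 1) ^ (1 - α) * Rbar ^ (2 * α / (2 - q)) *
      (sigmaSq lam₁ lam₂ / n * Real.log (((p : ℝ) - 1) / Rbar ^ (2 / (2 - q)))) ^ (q / 2) ∧
    1 ≤ Rbar ∧ Rbar ≤ (Real.exp 1)⁻¹ * ((p : ℝ) - 1) ^ (1 - q / 2)

/-- The covariance matrix of a random vector. -/
def covMatrix {Ω : Type u} [MeasurableSpace Ω] (P : Measure Ω) {p : ℕ} (Y : Ω → Vec p) :
    Matrix (Fin p) (Fin p) ℝ :=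
  Matrix.of fun j k => cov[fun ω => Y ω j, fun ω => Y ω k; P]

/-- The Orlicz `ψ_a`-norm `inf {c > 0 : E exp(|Y/c|^a) ≤ 2}`, with value `∞` if there is no such
`c`. -/
def orliczNorm {Ω : Type u} [MeasurableSpace Ω] (P : Measure Ω) (a : ℝ) (Y : Ω → ℝ) : ℝ≥0∞ :=
  ⨅ (c : ℝ) (_ : 0 < c) (_ : ∫⁻ ω, ENNReal.ofReal (Real.exp (|Y ω / c| ^ a)) ∂P ≤ 2),
    ENNReal.ofReal c

/-- `Y₁, …, Y_n` are independent and identically distributed random vectors. -/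
structure IsIID {Ω : Type u} [MeasurableSpace Ω] (P : Measure Ω) {n p : ℕ}
    (Y : Fin n → Ω → Vec p) : Prop where
  measurable : ∀ i, Measurable (Y i)
  indep : iIndepFun Y P
  identDistrib : ∀ i j, IdentDistrib (Y i) (Y j) P P

/-- The distribution of the i.i.d. sample `X` belongs to the model class
`M_q(λ₁, λ₂, Rbar, α, κ)`, with covariance matrix `Sig` and leading eigenvector `θ₁`
(which `Sig` determines up to its sign). -/
structure InModelClass {Ω : Type u} [MeasurableSpace Ω] (P : Measure Ω) {n p : ℕ}
    (X : Fin n → Ω → Vec p) (q lam₁ lam₂ Rbar α κ : ℝ)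
    (Sig : Matrix (Fin p) (Fin p) ℝ) (θ₁ : Vec p) : Prop where
  iid : IsIID P X
  memLp : ∀ i, MemLp (X i) 2 P
  cov_eq : ∀ i, covMatrix P (X i) = Sig
  spiked : IsSpiked Sig lam₁ lam₂ θ₁
  mem_ball : θ₁ ∈ lqBall q p (Rbar + 1)
  radius : RadiusCondition q n p lam₁ lam₂ Rbar α κ

open scoped MatrixOrder in
/-- The sub-Gaussian assumption: `X_i = μ + Sig^{1/2} Z_i` almost surely, for i.i.d. random vectors
`Z_i` with `E Z_i = 0`, `E Z_i Z_iᵀ = I` and `sup_{‖x‖ = 1} ‖⟨Z_i, x⟩‖_{ψ₂} ≤ K`. -/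
def SubGaussianAssumption {Ω : Type u} [MeasurableSpace Ω] (P : Measure Ω) {n p : ℕ}
    (X : Fin n → Ω → Vec p) (Sig : Matrix (Fin p) (Fin p) ℝ) (K : ℝ) : Prop :=
  ∃ (Z : Fin n → Ω → Vec p) (m : Vec p),
    IsIID P Z ∧
    (∀ i j, ∫ ω, Z i ω j ∂P = 0) ∧
    (∀ i j k, ∫ ω, Z i ω j * Z i ω k ∂P = (1 : Matrix (Fin p) (Fin p) ℝ) j k) ∧
    (∀ i, ∀ᵐ ω ∂P, X i ω = m + Matrix.toEuclideanCLM (n := Fin p) (𝕜 := ℝ) (CFC.sqrt Sig) (Z i ω)) ∧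
    (∀ i, ⨆ x ∈ Metric.sphere (0 : Vec p) 1,
      orliczNorm P 2 (fun ω => inner ℝ (Z i ω) x) ≤ ENNReal.ofReal K)

end

end SparsePCA

/-! Comparing θ̂₁ with the feasible point θ₁, the spectral gap yields `IsSpiked.curvature`:
(λ₁-λ₂)ε²/2 is at most the increment of the quadratic form of the noise W = S - Σ from θ₁ to b =
θ̂₁. Everything then rests on a bound M for ⟨x, Wy⟩ over x, y in the unit ball with ℓ₁-norm at most
r, and each q uses it differently. For q = 0 (r = √(2R)) the increment is ⟨b-θ₁, W(b+θ₁)⟩, both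
arguments are 2R-sparse, and ‖b-θ₁‖‖b+θ₁‖ = √2 ε, so one factor ε cancels and ε is of order
M/(λ₁-λ₂). For q = 1 (r = R) both vectors lie in the ℓ₁ ball and nothing cancels, so that ε² is of
order M/(λ₁-λ₂); this is the source of the square root in the rate. For 0 < q < 1 only the entries
of W are needed (r = 1): the increment is at most M times the entrywise ℓ₁-norm of bbᵀ-θ₁θ₁ᵀ, whose
entries have ℓ_q sum at most 2R², and thresholding them gives R²(M/(λ₁-λ₂))^(2-q). The bound M comes
from `exists_bound_bilinear`. If r² ≤ 4s, linear functionals on the ℓ₁/ℓ₂ intersection are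
controlled by s-sparse vectors, hence by a finite set of size C(p,s)·5^s
(`exists_finset_dominating`). In a fixed direction u, uᵀSu is the empirical variance of ⟨Z_i,
Σ^{1/2}u⟩, built from averages of independent centered variables with exponential moments; a union
bound at the level of moments (`exists_bound_max_average`) shows that M² has expectation of order
K⁴λ₁²·s log(ep/s)/n when s log(ep/s)/n is small. When it is not small, the claimed rate is bounded
below by a constant and ε² ≤ 2 suffices (`le_mul_min_of`). -/

namespace SparsePCA

/-! ### Quadratic forms and the distance between rank-one projectors -/

/-- A matrix as an operator on Euclidean space. -/
noncomputable abbrev op {p : ℕ} (A : Matrix (Fin p) (Fin p) ℝ) : Vec p →L[ℝ] Vec p :=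
  Matrix.toEuclideanCLM (n := Fin p) (𝕜 := ℝ) A

theorem quadForm_eq_inner {p : ℕ} (A : Matrix (Fin p) (Fin p) ℝ) (b : Vec p) :
    quadForm A b = inner ℝ b (op A b) := by
  rw [Matrix.inner_toEuclideanCLM]
  simp only [quadForm, dotProduct, Matrix.mulVec, Finset.mul_sum]
  refine Finset.sum_congr rfl fun j _ => Finset.sum_congr rfl fun k _ => by ring

theorem op_outer {p : ℕ} (θ x : Vec p) : op (outer θ) x = inner ℝ θ x • θ := by
  ext j
  rw [Matrix.ofLp_toEuclideanCLM]
  simp only [Matrix.mulVec, dotProduct, outer, Matrix.of_apply, PiLp.inner_apply, PiLp.smul_apply,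
    smul_eq_mul, Finset.sum_mul]
  refine Finset.sum_congr rfl fun k _ => by simp; ring

theorem op_symm {p : ℕ} {A : Matrix (Fin p) (Fin p) ℝ} (hA : A.IsHermitian) (x y : Vec p) :
    inner ℝ x (op A y) = inner ℝ (op A x) y := by
  have h : (op A).adjoint = op A := by
    rw [← ContinuousLinearMap.star_eq_adjoint, ← map_star, Matrix.star_eq_conjTranspose, hA.eq]
  rw [← ContinuousLinearMap.adjoint_inner_left, h]

theorem outer_isHermitian {p : ℕ} (θ : Vec p) : (outer θ).IsHermitian := by
  ext j k
  simp [outer, mul_comm]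

theorem sampleCov_isHermitian {n p : ℕ} (x : Fin n → Vec p) : (sampleCov x).IsHermitian := by
  unfold sampleCov
  refine Matrix.IsHermitian.sub ?_ (outer_isHermitian _)
  rw [Matrix.IsHermitian, Matrix.conjTranspose_smul, Matrix.conjTranspose_sum]
  simp only [(outer_isHermitian _).eq, star_trivial]

theorem frobNorm_sq {p : ℕ} (A : Matrix (Fin p) (Fin p) ℝ) :
    frobNorm A ^ 2 = ∑ j, ∑ k, A j k ^ 2 :=
  Real.sq_sqrt (Finset.sum_nonneg fun _ _ => Finset.sum_nonneg fun _ _ => sq_nonneg _)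

theorem frobNorm_nonneg {p : ℕ} (A : Matrix (Fin p) (Fin p) ℝ) : 0 ≤ frobNorm A :=
  Real.sqrt_nonneg _

theorem frobNorm_outer_sub_sq {p : ℕ} {a b : Vec p} (ha : ‖a‖ = 1) (hb : ‖b‖ = 1) :
    frobNorm (outer a - outer b) ^ 2 = 2 * (1 - inner ℝ a b ^ 2) := by
  have ha2 : ∑ j, a j * a j = 1 := by
    have := EuclideanSpace.real_norm_sq_eq a
    rw [ha] at this
    simp only [← pow_two]; linarith
  have hb2 : ∑ j, b j * b j = 1 := by
    have := EuclideanSpace.real_norm_sq_eq b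
    rw [hb] at this
    simp only [← pow_two]; linarith
  have hab : (inner ℝ a b : ℝ) = ∑ j, a j * b j := by
    rw [PiLp.inner_apply]
    exact Finset.sum_congr rfl fun k _ => by simp [mul_comm]
  rw [frobNorm_sq]
  have : ∀ j k, (outer a - outer b) j k ^ 2 = (a j * a j) * (a k * a k)
      - 2 * ((a j * b j) * (a k * b k)) + (b j * b j) * (b k * b k) := by
    intro j k
    simp only [outer, Matrix.sub_apply, Matrix.of_apply]; ring
  simp only [this, Finset.sum_add_distrib, Finset.sum_sub_distrib, ← Finset.mul_sum,
    ← Finset.sum_mul, ha2, hb2]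
  rw [hab]; ring

theorem frobNorm_outer_sub_sq_le {p : ℕ} {a b : Vec p} (ha : ‖a‖ = 1) (hb : ‖b‖ = 1) :
    frobNorm (outer a - outer b) ^ 2 ≤ 2 := by
  rw [frobNorm_outer_sub_sq ha hb]
  nlinarith [sq_nonneg (inner ℝ a b : ℝ)]

/-! ### The spiked covariance matrix and the curvature of its quadratic form -/

theorem IsSpiked.isHermitian {p : ℕ} {Sig : Matrix (Fin p) (Fin p) ℝ} {lam₁ lam₂ : ℝ} {θ₁ : Vec p}
    (h : IsSpiked Sig lam₁ lam₂ θ₁) : Sig.IsHermitian := by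
  obtain ⟨-, -, -, Sig₀, hp, -, -, rfl⟩ := h
  rw [Matrix.IsHermitian, Matrix.conjTranspose_add, Matrix.conjTranspose_smul,
    Matrix.conjTranspose_smul, (outer_isHermitian θ₁).eq, hp.isHermitian.eq]
  simp

/-- `Sig₀` annihilates θ₁, so its form sees only the component of b orthogonal to θ₁, where the
spectral norm 1 bounds it. -/
theorem IsSpiked.quadForm_eq_of {p : ℕ} {Sig : Matrix (Fin p) (Fin p) ℝ} {lam₁ lam₂ : ℝ}
    {θ₁ : Vec p} (h : IsSpiked Sig lam₁ lam₂ θ₁) (b : Vec p) :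
    0 ≤ quadForm Sig b ∧
      quadForm Sig b ≤ lam₁ * inner ℝ θ₁ b ^ 2 + lam₂ * (‖b‖ ^ 2 - inner ℝ θ₁ b ^ 2) := by
  obtain ⟨h2, h12, hθ, Sig₀, hp, h0, hn, rfl⟩ := h
  have hθ1 : ‖θ₁‖ = 1 := by simpa using hθ
  have h0' : op Sig₀ θ₁ = 0 := by
    ext j
    rw [Matrix.ofLp_toEuclideanCLM, h0]; rfl
  set c : ℝ := inner ℝ θ₁ b with hc
  have hθθ : inner ℝ θ₁ θ₁ = (1 : ℝ) := by rw [real_inner_self_eq_norm_sq, hθ1]; norm_num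
  have hq : quadForm (lam₁ • outer θ₁ + lam₂ • Sig₀) b
      = lam₁ * c ^ 2 + lam₂ * inner ℝ b (op Sig₀ b) := by
    rw [quadForm_eq_inner]
    simp only [op, map_add, map_smul, add_apply,
      smul_apply, inner_add_right, inner_smul_right]
    rw [← op, ← op, op_outer, inner_smul_right, real_inner_comm θ₁ b, ← hc]
    ring
  have hpos : 0 ≤ inner ℝ b (op Sig₀ b) := by
    rw [Matrix.inner_toEuclideanCLM]
    simpa using hp.dotProduct_mulVec_nonneg b
  have hw : inner ℝ b (op Sig₀ b) = inner ℝ (b - c • θ₁) (op Sig₀ (b - c • θ₁)) := by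
    rw [map_sub, map_smul, h0', smul_zero, sub_zero, inner_sub_left, inner_smul_left,
      op_symm hp.isHermitian θ₁ b, h0']
    simp
  have hle : inner ℝ b (op Sig₀ b) ≤ ‖b - c • θ₁‖ ^ 2 := by
    rw [hw]
    refine (real_inner_le_norm _ _).trans ?_
    have := (op Sig₀).le_opNorm (b - c • θ₁)
    rw [show ‖op Sig₀‖ = 1 from hn, one_mul] at this
    nlinarith [norm_nonneg (b - c • θ₁)]
  have hnorm : ‖b - c • θ₁‖ ^ 2 = ‖b‖ ^ 2 - c ^ 2 := by
    rw [norm_sub_sq_real, inner_smul_right, norm_smul, hθ1, real_inner_comm, ← hc]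
    simp; ring
  rw [hq]
  constructor
  · have : 0 ≤ lam₁ := by linarith
    positivity
  · rw [hnorm] at hle
    nlinarith [mul_le_mul_of_nonneg_left hle h2]

theorem IsSpiked.quadForm_self {p : ℕ} {Sig : Matrix (Fin p) (Fin p) ℝ} {lam₁ lam₂ : ℝ}
    {θ₁ : Vec p} (h : IsSpiked Sig lam₁ lam₂ θ₁) : quadForm Sig θ₁ = lam₁ := by
  obtain ⟨h2, h12, hθ, Sig₀, hp, h0, hn, rfl⟩ := h
  have hθ1 : ‖θ₁‖ = 1 := by simpa using hθ
  have h0' : op Sig₀ θ₁ = 0 := by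
    ext j
    rw [Matrix.ofLp_toEuclideanCLM, h0]; rfl
  rw [quadForm_eq_inner]
  simp only [op, map_add, map_smul, add_apply,
      smul_apply, inner_add_right, inner_smul_right]
  rw [← op, ← op, op_outer, h0', inner_smul_right, real_inner_self_eq_norm_sq, hθ1]
  simp

theorem IsSpiked.quadForm_le {p : ℕ} {Sig : Matrix (Fin p) (Fin p) ℝ} {lam₁ lam₂ : ℝ}
    {θ₁ : Vec p} (h : IsSpiked Sig lam₁ lam₂ θ₁) (b : Vec p) :
    quadForm Sig b ≤ lam₁ * ‖b‖ ^ 2 := by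
  have h1 := (h.quadForm_eq_of b).2
  obtain ⟨h2, h12, hθ, -⟩ := h
  have hθ1 : ‖θ₁‖ = 1 := by simpa using hθ
  have h3 : (inner ℝ θ₁ b : ℝ) ^ 2 ≤ ‖b‖ ^ 2 := by
    rw [← sq_abs]
    have := abs_real_inner_le_norm θ₁ b
    rw [hθ1, one_mul] at this
    gcongr
  nlinarith [mul_nonneg (sub_nonneg.2 h12.le) (sub_nonneg.2 h3)]

theorem IsSpiked.posSemidef {p : ℕ} {Sig : Matrix (Fin p) (Fin p) ℝ} {lam₁ lam₂ : ℝ} {θ₁ : Vec p}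
    (h : IsSpiked Sig lam₁ lam₂ θ₁) : Sig.PosSemidef := by
  refine Matrix.PosSemidef.of_dotProduct_mulVec_nonneg h.isHermitian fun x => ?_
  have := (h.quadForm_eq_of (WithLp.toLp 2 x)).1
  rw [quadForm_eq_inner, Matrix.inner_toEuclideanCLM] at this
  simpa using this

theorem quadForm_sub {p : ℕ} (A B : Matrix (Fin p) (Fin p) ℝ) (b : Vec p) :
    quadForm (A - B) b = quadForm A b - quadForm B b := by
  rw [quadForm_eq_inner, quadForm_eq_inner, quadForm_eq_inner, op, map_sub,
    sub_apply, inner_sub_right]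

/-- The projector error of a maximizer of `bᵀ S b` is controlled by the noise `S - Sig`. -/
theorem IsSpiked.curvature {p : ℕ} {Sig S : Matrix (Fin p) (Fin p) ℝ} {lam₁ lam₂ : ℝ}
    {θ₁ b : Vec p} (h : IsSpiked Sig lam₁ lam₂ θ₁) (hb : ‖b‖ = 1)
    (hS : quadForm S θ₁ ≤ quadForm S b) :
    (lam₁ - lam₂) / 2 * frobNorm (outer b - outer θ₁) ^ 2
      ≤ quadForm (S - Sig) b - quadForm (S - Sig) θ₁ := by
  have hθ1 : ‖θ₁‖ = 1 := by simpa using h.2.2.1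
  rw [frobNorm_outer_sub_sq hb hθ1, quadForm_sub, quadForm_sub, h.quadForm_self]
  have h1 := (h.quadForm_eq_of b).2
  rw [hb, real_inner_comm] at h1
  nlinarith

/-- The cross terms cancel by symmetry. The factored form lets the increment be measured by
‖a-b‖‖a+b‖, which is proportional to the projector distance. -/
theorem quadForm_sub_quadForm {p : ℕ} {A : Matrix (Fin p) (Fin p) ℝ} (hA : A.IsHermitian)
    (a b : Vec p) : quadForm A a - quadForm A b = inner ℝ (a - b) (op A (a + b)) := by
  rw [quadForm_eq_inner, quadForm_eq_inner, map_add, inner_add_right, inner_sub_left,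
    inner_sub_left, op_symm hA a b, real_inner_comm b]
  ring

theorem norm_sub_mul_norm_add_sq {p : ℕ} {a b : Vec p} (ha : ‖a‖ = 1) (hb : ‖b‖ = 1) :
    (‖a - b‖ * ‖a + b‖) ^ 2 = 2 * frobNorm (outer a - outer b) ^ 2 := by
  rw [frobNorm_outer_sub_sq ha hb, mul_pow, norm_sub_sq_real, norm_add_sq_real, ha, hb]
  ring

theorem inner_op_eq_quadForm_sub {p : ℕ} {A : Matrix (Fin p) (Fin p) ℝ} (hA : A.IsHermitian)
    (a b : Vec p) : inner ℝ a (op A b)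
      = quadForm A ((1 / 2 : ℝ) • (a + b)) - quadForm A ((1 / 2 : ℝ) • (a - b)) := by
  rw [quadForm_sub_quadForm hA, op_symm hA, real_inner_comm]
  congr 1
  · module
  · congr 1; module

/-! ### Finite sets dominating the intersection of an ℓ₁ and an ℓ₂ ball -/

/-- The unit ball of a `d`-dimensional Euclidean space has a `1/2`-net of at most `5 ^ d` points. -/
theorem exists_finset_half_net (E : Type*) [NormedAddCommGroup E] [NormedSpace ℝ E]
    [FiniteDimensional ℝ E] :
    ∃ F : Finset E, F.card ≤ 5 ^ Module.finrank ℝ E ∧ (∀ v ∈ F, ‖v‖ ≤ 1) ∧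
      ∀ x : E, ‖x‖ ≤ 1 → ∃ v ∈ F, ‖x - v‖ ≤ 1 / 2 := by
  classical
  let Q : Finset E → Prop := fun F => (∀ v ∈ F, ‖v‖ ≤ 1) ∧
    ∀ v ∈ F, ∀ w ∈ F, v ≠ w → 1 / 2 ≤ ‖v - w‖
  have hcard : ∀ F, Q F → F.card ≤ 5 ^ Module.finrank ℝ E := by
    intro F hF
    -- Doubling turns 1/2-separated points of the unit ball into 1-separated points of the ball of
    -- radius 2, the setting of `Besicovitch.card_le_of_separated`.
    have hinj : Function.Injective fun v : E => (2 : ℝ) • v := smul_right_injective E two_ne_zero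
    rw [← Finset.card_image_of_injective F hinj]
    refine Besicovitch.card_le_of_separated _ ?_ ?_
    · intro c hc
      obtain ⟨v, hv, rfl⟩ := Finset.mem_image.1 hc
      rw [norm_smul]; norm_num; linarith [hF.1 v hv]
    · intro c hc d hd hne
      obtain ⟨v, hv, rfl⟩ := Finset.mem_image.1 hc
      obtain ⟨w, hw, rfl⟩ := Finset.mem_image.1 hd
      have := hF.2 v hv w hw (fun h => hne (by rw [h]))
      simp only [← smul_sub, norm_smul]; norm_num; linarith
  let D : Set ℕ := {k | ∃ F, Q F ∧ F.card = k}
  have hfin : D.Finite := (Set.finite_Iic (5 ^ Module.finrank ℝ E)).subset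
    fun k ⟨F, hF, hk⟩ => hk ▸ hcard F hF
  -- A separated set of largest cardinality is a net: a point farther than 1/2 from all of it could
  -- be added.
  obtain ⟨k, ⟨F, hF, rfl⟩, hmax⟩ :=
    hfin.exists_maximal (⟨0, ∅, ⟨by simp, by simp⟩, rfl⟩ : D.Nonempty)
  refine ⟨F, hcard F hF, hF.1, fun x hx => ?_⟩
  by_contra! hcon
  have hxF : x ∉ F := fun h => by
    have := hcon x h
    norm_num at this
  have hQ : Q (insert x F) := by
    refine ⟨fun v hv => ?_, fun v hv w hw hne => ?_⟩
    · rcases Finset.mem_insert.1 hv with rfl | hv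
      exacts [hx, hF.1 v hv]
    · rcases Finset.mem_insert.1 hv with rfl | hv' <;>
        rcases Finset.mem_insert.1 hw with rfl | hw'
      · exact absurd rfl hne
      · exact (hcon w hw').le
      · rw [norm_sub_rev]; exact (hcon v hv').le
      · exact hF.2 v hv' w hw' hne
  have h1 := hmax ⟨insert x F, hQ, rfl⟩ (by
    rw [Finset.card_insert_of_notMem hxF]; exact Nat.le_succ _)
  rw [Finset.card_insert_of_notMem hxF] at h1
  omega

/-- Extension by zero of a vector indexed by a set of coordinates. -/
noncomputable def extendZero {p : ℕ} (T : Finset (Fin p)) (v : EuclideanSpace ℝ T) : Vec p :=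
  WithLp.toLp 2 fun j => if h : j ∈ T then v ⟨j, h⟩ else 0

theorem inner_extendZero {p : ℕ} (T : Finset (Fin p)) (v : EuclideanSpace ℝ T) (g : Vec p) :
    inner ℝ (extendZero T v) g
      = inner ℝ v (WithLp.toLp 2 fun j : T => g j : EuclideanSpace ℝ T) := by
  rw [PiLp.inner_apply, PiLp.inner_apply, ← Finset.sum_subset (Finset.subset_univ T)]
  · rw [← Finset.sum_coe_sort T]
    refine Finset.sum_congr rfl fun j _ => ?_
    simp [extendZero]
  · intro j _ hj
    simp [extendZero, hj]

theorem norm_extendZero {p : ℕ} (T : Finset (Fin p)) (v : EuclideanSpace ℝ T) :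
    ‖extendZero T v‖ = ‖v‖ := by
  have h := inner_extendZero T v (extendZero T v)
  rw [real_inner_self_eq_norm_sq] at h
  have h2 : (WithLp.toLp 2 fun j : T => extendZero T v j : EuclideanSpace ℝ T) = v := by
    ext j
    simp [extendZero]
  rw [h2, real_inner_self_eq_norm_sq] at h
  exact (sq_eq_sq₀ (norm_nonneg _) (norm_nonneg _)).1 h

/-- There are `s` coordinates of `g` dominating all the others. -/
theorem exists_top_coords {p : ℕ} (g : Fin p → ℝ) {s : ℕ} (hs : s ≤ p) :
    ∃ T : Finset (Fin p), T.card = s ∧ ∀ i ∈ T, ∀ j ∉ T, g j ≤ g i := by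
  induction s with
  | zero => exact ⟨∅, rfl, by simp⟩
  | succ s ih =>
    obtain ⟨T, hT, h⟩ := ih (by omega)
    have hne : (Finset.univ \ T).Nonempty := by
      rw [← Finset.card_pos, Finset.card_sdiff_of_subset (Finset.subset_univ T)]
      simp; omega
    obtain ⟨m, hm, hmax⟩ := Finset.exists_max_image _ g hne
    simp only [Finset.mem_sdiff, Finset.mem_univ, true_and] at hm hmax
    refine ⟨insert m T, by rw [Finset.card_insert_of_notMem hm, hT], fun i hi j hj => ?_⟩
    simp only [Finset.mem_insert, not_or] at hi hj
    rcases hi with rfl | hi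
    exacts [hmax j hj.2, h i hi j hj.2]

/-- A linear functional on the intersection of an `ℓ₁` and an `ℓ₂` ball is controlled by its norm
on some set of `s` coordinates. -/
theorem exists_inner_le_restrict {p s : ℕ} (hs : s ≤ p) {r : ℝ} (hr : 0 ≤ r)
    (hrs : r ^ 2 ≤ 4 * s) (g : Vec p) :
    ∃ T : Finset (Fin p), T.card = s ∧ ∀ x : Vec p, ‖x‖ ≤ 1 → ∑ j, |x j| ≤ r →
      inner ℝ x g ≤ 3 * ‖(WithLp.toLp 2 fun j : T => g j : EuclideanSpace ℝ T)‖ := by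
  obtain ⟨T, hT, h⟩ := exists_top_coords (fun j => |g j|) hs
  refine ⟨T, hT, fun x hx hx1 => ?_⟩
  set G := ‖(WithLp.toLp 2 fun j : T => g j : EuclideanSpace ℝ T)‖ with hG
  have hGsq : G ^ 2 = ∑ j ∈ T, g j ^ 2 := by
    rw [hG, EuclideanSpace.real_norm_sq_eq, ← Finset.sum_coe_sort T]
  have hG0 : 0 ≤ G := norm_nonneg _
  -- All s coordinates in T dominate |g j|, so |g j| ≤ G/√s, while r ≤ 2√s. The ℓ₁ budget outside T
  -- thus costs 2G, and Cauchy-Schwarz inside T costs G.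
  have hout : ∀ j ∉ T, r * |g j| ≤ 2 * G := by
    intro j hj
    refine le_of_sq_le_sq ?_ (by positivity)
    have h1 : (s : ℝ) * |g j| ^ 2 ≤ G ^ 2 := by
      rw [hGsq, ← hT, ← nsmul_eq_mul]
      refine Finset.card_nsmul_le_sum _ _ _ fun i hi => ?_
      rw [← sq_abs (g i)]
      exact pow_le_pow_left₀ (abs_nonneg _) (h i hi j hj) 2
    calc (r * |g j|) ^ 2 = r ^ 2 * |g j| ^ 2 := by ring
      _ ≤ 4 * s * |g j| ^ 2 := by gcongr
      _ ≤ (2 * G) ^ 2 := by nlinarith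
  have hin : ∑ j ∈ T, x j * g j ≤ G := by
    refine le_of_sq_le_sq ((Finset.sum_mul_sq_le_sq_mul_sq T _ _).trans ?_) hG0
    rw [← hGsq]
    have : ∑ j ∈ T, x j ^ 2 ≤ 1 := by
      calc ∑ j ∈ T, x j ^ 2 ≤ ∑ j, x j ^ 2 :=
            Finset.sum_le_sum_of_subset_of_nonneg (Finset.subset_univ T)
              fun _ _ _ => sq_nonneg _
        _ = ‖x‖ ^ 2 := (EuclideanSpace.real_norm_sq_eq x).symm
        _ ≤ 1 := by nlinarith [norm_nonneg x]
    nlinarith [sq_nonneg G]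
  have hout' : ∑ j ∈ Tᶜ, x j * g j ≤ 2 * G := by
    rcases hr.eq_or_lt with rfl | hr0
    · have h0 : ∀ j, x j = 0 := fun j => by
        have := Finset.single_le_sum (fun i _ => abs_nonneg (x i)) (Finset.mem_univ j)
        exact abs_eq_zero.1 (le_antisymm (this.trans hx1) (abs_nonneg _))
      simp [h0]; exact hG0
    · calc ∑ j ∈ Tᶜ, x j * g j ≤ ∑ j ∈ Tᶜ, |x j| * (2 * G / r) := by
            refine Finset.sum_le_sum fun j hj => (le_abs_self _).trans ?_
            rw [abs_mul]
            gcongr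
            rw [le_div_iff₀ hr0, mul_comm]
            exact hout j (Finset.mem_compl.1 hj)
        _ ≤ (∑ j, |x j|) * (2 * G / r) := by
            rw [← Finset.sum_mul]
            gcongr
            exact Finset.subset_univ _
        _ ≤ r * (2 * G / r) := by gcongr
        _ = 2 * G := by field_simp
  have : inner ℝ x g = ∑ j ∈ T, x j * g j + ∑ j ∈ Tᶜ, x j * g j := by
    rw [Finset.sum_add_sum_compl, PiLp.inner_apply]
    exact Finset.sum_congr rfl fun k _ => by simp [mul_comm]
  linarith

/-- A finite set controlling all linear functionals on the intersection of an `ℓ₁` and an `ℓ₂`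
ball. -/
theorem exists_finset_dominating {p s : ℕ} (hs : s ≤ p) {r : ℝ} (hr : 0 ≤ r)
    (hrs : r ^ 2 ≤ 4 * s) :
    ∃ N : Finset (Vec p), N.card ≤ p.choose s * 5 ^ s ∧ (∀ v ∈ N, ‖v‖ ≤ 1) ∧
      ∀ (g : Vec p) (B : ℝ), (∀ v ∈ N, inner ℝ v g ≤ B) →
        ∀ x : Vec p, ‖x‖ ≤ 1 → ∑ j, |x j| ≤ r → inner ℝ x g ≤ 6 * B := by
  classical
  choose F hFc hF1 hF using fun T : Finset (Fin p) => exists_finset_half_net (EuclideanSpace ℝ T)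
  refine ⟨(Finset.powersetCard s Finset.univ).biUnion fun T => (F T).image (extendZero T),
    ?_, ?_, ?_⟩
  · calc _ ≤ (Finset.powersetCard s (Finset.univ : Finset (Fin p))).card * 5 ^ s := by
          refine Finset.card_biUnion_le_card_mul _ _ _ fun T hT => Finset.card_image_le.trans ?_
          have := hFc T
          rwa [finrank_euclideanSpace, Fintype.card_coe, (Finset.mem_powersetCard.1 hT).2] at this
      _ = _ := by simp
  · intro v hv
    obtain ⟨T, -, hv⟩ := Finset.mem_biUnion.1 hv
    obtain ⟨w, hw, rfl⟩ := Finset.mem_image.1 hv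
    rw [norm_extendZero]; exact hF1 T w hw
  · intro g B hB x hx hx1
    obtain ⟨T, hT, h⟩ := exists_inner_le_restrict hs hr hrs g
    set gT : EuclideanSpace ℝ T := WithLp.toLp 2 fun j : T => g j with hgT
    have key : ‖gT‖ ≤ 2 * B := by
      have hmem : ∀ v ∈ F T, inner ℝ v gT ≤ B := fun v hv => by
        rw [← inner_extendZero]
        exact hB _ (Finset.mem_biUnion.2 ⟨T, Finset.mem_powersetCard.2 ⟨Finset.subset_univ _, hT⟩,
          Finset.mem_image_of_mem _ hv⟩)
      -- The normalized vector attains ‖gT‖, and a net point within 1/2 of it loses at most half.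
      -- For gT = 0 the inverse is 0 and the same identity holds.
      have hn : ‖(‖gT‖⁻¹ • gT)‖ ≤ 1 := by
        rw [norm_smul, norm_inv, norm_norm]
        exact inv_mul_le_one
      obtain ⟨v, hv, hxv⟩ := hF T _ hn
      have h1 : inner ℝ (‖gT‖⁻¹ • gT) gT = ‖gT‖ := by
        rw [inner_smul_left, real_inner_self_eq_norm_sq]
        rcases eq_or_ne ‖gT‖ 0 with h0 | h0
        · simp [h0]
        · simp; field_simp
      have h2 : inner ℝ (‖gT‖⁻¹ • gT - v) gT ≤ 1 / 2 * ‖gT‖ :=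
        (real_inner_le_norm _ _).trans (by gcongr)
      rw [inner_sub_left, h1] at h2
      linarith [hmem v hv]
    linarith [h x hx hx1]

/-- Bilinear version of domination. -/
theorem inner_op_le_of_dominating {p : ℕ} {A : Matrix (Fin p) (Fin p) ℝ} (hA : A.IsHermitian)
    {r : ℝ} {N : Finset (Vec p)}
    (hN : ∀ (g : Vec p) (B : ℝ), (∀ v ∈ N, inner ℝ v g ≤ B) →
        ∀ x : Vec p, ‖x‖ ≤ 1 → ∑ j, |x j| ≤ r → inner ℝ x g ≤ 6 * B)
    {B : ℝ} (hB : ∀ v ∈ N, ∀ w ∈ N, inner ℝ v (op A w) ≤ B) {x y : Vec p}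
    (hx : ‖x‖ ≤ 1) (hx1 : ∑ j, |x j| ≤ r) (hy : ‖y‖ ≤ 1) (hy1 : ∑ j, |y j| ≤ r) :
    inner ℝ x (op A y) ≤ 36 * B := by
  have h1 : ∀ v ∈ N, inner ℝ v (op A y) ≤ 6 * B := fun v hv => by
    rw [op_symm hA, real_inner_comm]
    refine hN _ B (fun w hw => ?_) y hy hy1
    rw [real_inner_comm, ← op_symm hA]
    exact hB v hv w hw
  have := hN _ _ h1 x hx hx1
  linarith

/-- The size of the dominating set. -/
theorem choose_mul_five_pow_le {p s : ℕ} (hs1 : 1 ≤ s) (hs : s ≤ p) :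
    2 * ((p.choose s * 5 ^ s : ℕ) : ℝ) ^ 2
      ≤ Real.exp (7 * (s * Real.log (Real.exp 1 * p / s))) := by
  have hs0 : (0 : ℝ) < s := by exact_mod_cast hs1
  have hp0 : (0 : ℝ) < p := by exact_mod_cast (by omega : 0 < p)
  have hsp : (s : ℝ) ≤ p := by exact_mod_cast hs
  set y := Real.exp 1 * p / s with hy
  have hy0 : 0 < y := by positivity
  have hye : Real.exp 1 ≤ y := by
    rw [hy, le_div_iff₀ hs0]; gcongr
  have hch : (p.choose s : ℝ) ≤ y ^ s := by
    have h1 : (s : ℝ) ^ s / s.factorial ≤ Real.exp s := Real.pow_div_factorial_le_exp _ hs0.le s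
    have h2 : (p.choose s : ℝ) ≤ p ^ s / s.factorial := Nat.choose_le_pow_div s p
    refine h2.trans ?_
    have h3 : y ^ s = Real.exp s * (p ^ s / s ^ s) := by
      rw [hy, div_pow, mul_pow, ← Real.exp_nat_mul]; simp [mul_div_assoc]
    rw [h3]
    calc (p : ℝ) ^ s / s.factorial = (s : ℝ) ^ s / s.factorial * (p ^ s / s ^ s) := by
          field_simp
      _ ≤ _ := by gcongr
  have he : (2.7 : ℝ) < Real.exp 1 := by linarith [Real.exp_one_gt_d9]
  have hexp : Real.exp (7 * (s * Real.log y)) = (y ^ s) ^ 7 := by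
    rw [← mul_assoc, mul_comm, Real.exp_mul, Real.exp_log hy0, ← pow_mul, ← Real.rpow_natCast]
    push_cast; ring_nf
  have h5 : (5 : ℝ) ^ s ≤ (y ^ s) ^ 2 := by
    rw [← pow_mul, mul_comm, pow_mul]
    refine pow_le_pow_left₀ (by norm_num) ?_ s
    nlinarith
  have h2 : (2 : ℝ) ≤ y ^ s := by
    calc (2 : ℝ) ≤ y := by linarith
      _ = y ^ 1 := (pow_one y).symm
      _ ≤ y ^ s := pow_le_pow_right₀ (by linarith) hs1
  rw [hexp]
  push_cast
  set z := y ^ s with hz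
  have hz0 : 0 < z := by positivity
  -- One z pays for the factor 2, one for the binomial coefficient and two for 5^s; squaring gives 1
  -- + 2·(1+2) = 7.
  calc 2 * ((p.choose s : ℝ) * 5 ^ s) ^ 2 ≤ z * (z * z ^ 2) ^ 2 := by gcongr
    _ = z ^ 7 := by ring

/-! ### Exponential moments and maxima of averages -/

/-- The Taylor remainder is (lx)² exp|lx|. As |l| ≤ 1/2, its exponential uses only half of |x|; the
other half absorbs x², since x²/8 ≤ exp(|x|/2). -/
theorem exp_mul_le_quadratic {l x : ℝ} (hl : |l| ≤ 1 / 2) :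
    Real.exp (l * x) ≤ 1 + l * x + 8 * l ^ 2 * Real.exp |x| := by
  have h1 : Real.exp (l * x) ≤ 1 + l * x + (l * x) ^ 2 * Real.exp |l * x| := by
    have := Complex.norm_exp_sub_sum_le_norm_mul_exp ((l * x : ℝ) : ℂ) 2
    have h : Complex.exp ((l * x : ℝ) : ℂ) - ∑ m ∈ Finset.range 2, ((l * x : ℝ) : ℂ) ^ m / m.factorial
        = ((Real.exp (l * x) - (1 + l * x) : ℝ) : ℂ) := by
      simp [Finset.sum_range_succ]
    rw [h, Complex.norm_real, Complex.norm_real, Real.norm_eq_abs, Real.norm_eq_abs, sq_abs] at this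
    linarith [(abs_le.1 this).2]
  have h2 : |x| ^ 2 / 8 ≤ Real.exp (|x| / 2) := by
    have := Real.pow_div_factorial_le_exp (|x| / 2) (by positivity) 2
    norm_num [Nat.factorial] at this
    nlinarith [sq_abs x]
  have h3 : Real.exp |l * x| ≤ Real.exp (|x| / 2) := by
    rw [abs_mul]; gcongr; nlinarith [abs_nonneg x]
  have h4 : Real.exp |x| = Real.exp (|x| / 2) * Real.exp (|x| / 2) := by
    rw [← Real.exp_add]; ring_nf
  have h5 : (l * x) ^ 2 * Real.exp |l * x| ≤ 8 * l ^ 2 * Real.exp |x| := by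
    calc (l * x) ^ 2 * Real.exp |l * x|
        ≤ (l * x) ^ 2 * Real.exp (|x| / 2) := by gcongr
      _ = 8 * l ^ 2 * (|x| ^ 2 / 8) * Real.exp (|x| / 2) := by rw [sq_abs]; ring
      _ ≤ 8 * l ^ 2 * Real.exp (|x| / 2) * Real.exp (|x| / 2) := by gcongr
      _ = _ := by rw [h4]; ring
  linarith

/-- A centered random variable with an exponential moment. -/
structure IsCenteredSubexp {Ω : Type u} [MeasurableSpace Ω] (P : Measure Ω) (C : ℝ)
    (U : Ω → ℝ) : Prop where
  measurable : Measurable U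
  integral_eq_zero : ∫ ω, U ω ∂P = 0
  integrable_exp : Integrable (fun ω => Real.exp |U ω|) P
  integral_exp_le : ∫ ω, Real.exp |U ω| ∂P ≤ C

section Probability

variable {Ω : Type u} [MeasurableSpace Ω] {P : Measure Ω}

theorem IsCenteredSubexp.integrable_exp_mul {C : ℝ} {U : Ω → ℝ} (h : IsCenteredSubexp P C U)
    {l : ℝ} (hl : |l| ≤ 1 / 2) : Integrable (fun ω => Real.exp (l * U ω)) P := by
  refine h.integrable_exp.mono' (by have := h.measurable; fun_prop) (ae_of_all _ fun ω => ?_)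
  rw [Real.norm_eq_abs, Real.abs_exp]
  refine Real.exp_le_exp.2 ((le_abs_self _).trans ?_)
  rw [abs_mul]; nlinarith [abs_nonneg (U ω)]

/-- Integrating the quadratic bound kills the linear term, which leaves 1 + 8Cl² ≤ exp(8Cl²). -/
theorem IsCenteredSubexp.mgf_le [IsProbabilityMeasure P] {C : ℝ} {U : Ω → ℝ} (h : IsCenteredSubexp P C U)
    {l : ℝ} (hl : |l| ≤ 1 / 2) : mgf U P l ≤ Real.exp (8 * C * l ^ 2) := by
  have hU : Integrable U P := h.integrable_exp.mono' h.measurable.aestronglyMeasurable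
    (ae_of_all _ fun ω => by rw [Real.norm_eq_abs]; linarith [Real.add_one_le_exp |U ω|])
  have h1 : mgf U P l ≤ ∫ ω, (1 + l * U ω + 8 * l ^ 2 * Real.exp |U ω|) ∂P :=
    integral_mono (h.integrable_exp_mul hl)
      (((integrable_const 1).add (hU.const_mul l)).add (h.integrable_exp.const_mul _))
      fun ω => exp_mul_le_quadratic hl
  rw [integral_add (by fun_prop) (h.integrable_exp.const_mul _),
    integral_add (by fun_prop) (hU.const_mul l), integral_const_mul, integral_const_mul,
    h.integral_eq_zero] at h1
  simp only [integral_const, probReal_univ, smul_eq_mul, mul_one, mul_zero, add_zero] at h1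
  have h2 := mul_le_mul_of_nonneg_left h.integral_exp_le (by positivity : 0 ≤ 8 * l ^ 2)
  linarith [Real.add_one_le_exp (8 * C * l ^ 2)]

/-- Below the level a the first term suffices; above it, the excess x - a is controlled by
exp(b(x-a)). Exponentials can be summed over a finite family, so this is the moment form of a union
bound. -/
theorem pow_le_add_exp {x a b : ℝ} (hx : 0 ≤ x) (ha : 0 ≤ a) (hb : 0 < b) (k : ℕ) :
    x ^ k ≤ 2 ^ (k - 1) * a ^ k
      + 2 ^ (k - 1) * (k.factorial / b ^ k) * (Real.exp (b * x) * Real.exp (-(b * a))) := by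
  rcases le_total x a with h | h
  · have h1 : x ^ k ≤ a ^ k := pow_le_pow_left₀ hx h k
    have h2 : (1 : ℝ) ≤ 2 ^ (k - 1) := one_le_pow₀ (by norm_num)
    have h3 : a ^ k ≤ 2 ^ (k - 1) * a ^ k := le_mul_of_one_le_left (by positivity) h2
    have : 0 ≤ 2 ^ (k - 1) * (k.factorial / b ^ k) * (Real.exp (b * x) * Real.exp (-(b * a))) := by
      positivity
    linarith
  · have h1 := add_pow_le ha (sub_nonneg.2 h) k
    rw [add_sub_cancel] at h1
    have h2 := Real.pow_div_factorial_le_exp (b * (x - a))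
      (mul_nonneg hb.le (sub_nonneg.2 h)) k
    have h3 : (x - a) ^ k ≤ k.factorial / b ^ k * (Real.exp (b * x) * Real.exp (-(b * a))) := by
      rw [← Real.exp_add, show b * x + -(b * a) = b * (x - a) by ring]
      rw [mul_pow, div_le_iff₀ (by positivity)] at h2
      rw [div_mul_eq_mul_div, le_div_iff₀ (by positivity)]
      linarith
    rw [mul_add] at h1
    refine h1.trans (add_le_add le_rfl ?_)
    rw [mul_assoc]
    gcongr

/-- Moments of the maximum of finitely many averages of independent centered random variables with
an exponential moment. -/
theorem exists_bound_max_average [IsProbabilityMeasure P] {ι : Type*} (V : Finset ι) {n : ℕ} {C L : ℝ} (hC : 0 ≤ C)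
    (U : ι → Fin n → Ω → ℝ) (hU : ∀ v ∈ V, ∀ i, IsCenteredSubexp P C (U v i))
    (hind : ∀ v ∈ V, iIndepFun (U v) P) (hV : (V.card : ℝ) ≤ Real.exp (n * L))
    (hL1 : 1 ≤ n * L) (hL : L ≤ 1 / 4) {k : ℕ} (hk : k ≠ 0) :
    ∃ G : Ω → ℝ, Integrable G P ∧ (∀ ω, 0 < G ω) ∧
      (∀ v ∈ V, ∀ ω, |(n : ℝ)⁻¹ * ∑ i, U v i ω| ^ k ≤ G ω) ∧
      ∫ ω, G ω ∂P ≤ (2 ^ (k - 1) * (8 * C + 1) ^ k + 2 ^ k * k.factorial) * (√L) ^ k := by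
  have hn0 : (0 : ℝ) < n := by
    rcases Nat.eq_zero_or_pos n with h | h
    · subst h; norm_num at hL1
    · exact_mod_cast h
  have hL0 : 0 < L := by
    by_contra! h
    nlinarith
  set l := √L with hl
  have hl0 : 0 < l := Real.sqrt_pos.2 hL0
  have hll : l ^ 2 = L := Real.sq_sqrt hL0.le
  have hl2 : |l| ≤ 1 / 2 := by
    rw [abs_of_pos hl0]
    nlinarith
  -- The level is chosen so that, with b = n·l, ab = nL + 8CnL: the factor exp(-ab) exactly cancels
  -- the cardinality exp(nL) and the moment generating function bound exp(8CnL).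
  set a := (8 * C + 1) * l with ha
  have ha0 : 0 < a := by positivity
  set b := n * l with hb
  have hb0 : 0 < b := by positivity
  set D : ℝ := 2 ^ (k - 1) * (k.factorial / b ^ k) * Real.exp (-(b * a)) with hD
  have hD0 : 0 ≤ D := by positivity
  have hmeas : ∀ v ∈ V, ∀ i, Measurable (U v i) := fun v hv i => (hU v hv i).measurable
  have hint : ∀ v ∈ V, ∀ t : ℝ, |t| ≤ 1 / 2 →
      Integrable (fun ω => Real.exp (t * ∑ i, U v i ω)) P := fun v hv t ht => by
    have := (hind v hv).integrable_exp_mul_sum (t := t) (s := Finset.univ) (hmeas v hv)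
      fun i _ => (hU v hv i).integrable_exp_mul ht
    simpa using this
  have hmgf : ∀ v ∈ V, ∀ t : ℝ, |t| ≤ 1 / 2 → t ^ 2 = L →
      ∫ ω, Real.exp (t * ∑ i, U v i ω) ∂P ≤ Real.exp (n * (8 * C * L)) := fun v hv t ht htL => by
    have h1 := (hind v hv).mgf_sum (t := t) (hmeas v hv) Finset.univ
    have h2 : mgf (∑ i, U v i) P t = ∫ ω, Real.exp (t * ∑ i, U v i ω) ∂P := by
      simp [mgf]
    rw [← h2, h1, ← nsmul_eq_mul, Real.exp_nsmul]
    calc ∏ i, mgf (U v i) P t ≤ ∏ _i : Fin n, Real.exp (8 * C * L) :=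
          Finset.prod_le_prod (fun _ _ => mgf_nonneg) fun i _ => by
            rw [← htL]; exact (hU v hv i).mgf_le ht
      _ = _ := by simp
  have hl2' : |-l| ≤ 1 / 2 := by rwa [abs_neg]
  refine ⟨fun ω => 2 ^ (k - 1) * a ^ k + ∑ v ∈ V, D * (Real.exp (l * ∑ i, U v i ω)
    + Real.exp (-l * ∑ i, U v i ω)), ?_, ?_, ?_, ?_⟩
  · exact (integrable_const _).add (integrable_finsetSum _ fun v hv =>
      ((hint v hv l hl2).add (hint v hv (-l) hl2')).const_mul D)
  · intro ω
    have : 0 ≤ ∑ v ∈ V, D * (Real.exp (l * ∑ i, U v i ω) + Real.exp (-l * ∑ i, U v i ω)) :=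
      Finset.sum_nonneg fun v _ => by positivity
    positivity
  · intro v hv ω
    set T := ∑ i, U v i ω with hT
    have h1 := pow_le_add_exp (abs_nonneg ((n : ℝ)⁻¹ * T)) ha0.le hb0 k
    have h2 : b * |(n : ℝ)⁻¹ * T| = |l * T| := by
      rw [abs_mul, abs_mul, abs_inv, abs_of_pos hn0, abs_of_pos hl0, hb]; field_simp
    have h3 : Real.exp |l * T| ≤ Real.exp (l * T) + Real.exp (-l * T) := by
      rcases abs_cases (l * T) with ⟨h, -⟩ | ⟨h, -⟩ <;> rw [h]
      · linarith [Real.exp_pos (-l * T)]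
      · rw [neg_mul]; linarith [Real.exp_pos (l * T)]
    have h4 := Finset.single_le_sum (f := fun v => D * (Real.exp (l * ∑ i, U v i ω)
      + Real.exp (-l * ∑ i, U v i ω))) (fun v _ => by positivity) hv
    refine h1.trans (add_le_add le_rfl (le_trans ?_ h4))
    rw [h2]
    calc _ = D * Real.exp |l * T| := by rw [hD]; ring
      _ ≤ _ := by gcongr
  · have hi : ∀ v ∈ V, Integrable (fun ω => D * (Real.exp (l * ∑ i, U v i ω)
        + Real.exp (-l * ∑ i, U v i ω))) P := fun v hv =>
      ((hint v hv l hl2).add (hint v hv (-l) hl2')).const_mul D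
    rw [integral_add (integrable_const _) (integrable_finsetSum _ hi), integral_finsetSum _ hi]
    simp only [integral_const, probReal_univ, smul_eq_mul, one_mul]
    have h1 : ∀ v ∈ V, ∫ ω, D * (Real.exp (l * ∑ i, U v i ω) + Real.exp (-l * ∑ i, U v i ω)) ∂P
        ≤ D * (2 * Real.exp (n * (8 * C * L))) := fun v hv => by
      rw [integral_const_mul, integral_add (hint v hv l hl2) (hint v hv (-l) hl2')]
      have := hmgf v hv l hl2 hll
      have := hmgf v hv (-l) hl2' (by rw [neg_sq, hll])
      gcongr
      linarith
    have h2 := Finset.sum_le_card_nsmul _ _ _ h1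
    rw [nsmul_eq_mul] at h2
    -- This is where 1 ≤ nL enters: the fluctuation scale 1/b is no larger than √L.
    have hbl : 1 / b ≤ l := by
      rw [div_le_iff₀ hb0, hb]
      calc 1 ≤ n * L := hL1
        _ = _ := by rw [← hll]; ring
    have h3 : (V.card : ℝ) * (D * (2 * Real.exp (n * (8 * C * L)))) ≤ 2 ^ k * k.factorial * l ^ k := by
      calc (V.card : ℝ) * (D * (2 * Real.exp (n * (8 * C * L))))
          ≤ Real.exp (n * L) * (D * (2 * Real.exp (n * (8 * C * L)))) := by gcongr
        _ = 2 * 2 ^ (k - 1) * k.factorial * (1 / b) ^ k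
            * (Real.exp (n * L) * Real.exp (-(b * a)) * Real.exp (n * (8 * C * L))) := by
            rw [hD, div_pow, one_pow]; ring
        _ = 2 ^ k * k.factorial * (1 / b) ^ k := by
            rw [← Real.exp_add, ← Real.exp_add, ← pow_succ', Nat.sub_add_cancel (by omega)]
            have : n * L + -(b * a) + n * (8 * C * L) = 0 := by
              rw [hb, ha, ← hll]; ring
            rw [this]; simp
        _ ≤ 2 ^ k * k.factorial * l ^ k := by gcongr
    calc _ ≤ 2 ^ (k - 1) * a ^ k + 2 ^ k * k.factorial * l ^ k := by linarith
      _ = _ := by rw [ha, mul_pow]; ring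

/-- The infimum defining the norm need not be attained, but some admissible c lies strictly below
2K; hence the doubled scale. -/
theorem integrable_exp_of_orliczNorm_le {K : ℝ} (hK : 0 < K) {Y : Ω → ℝ} (hY : Measurable Y)
    (h : orliczNorm P 2 Y ≤ ENNReal.ofReal K) :
    Integrable (fun ω => Real.exp ((Y ω / (2 * K)) ^ 2)) P ∧
      ∫ ω, Real.exp ((Y ω / (2 * K)) ^ 2) ∂P ≤ 2 := by
  have h1 : orliczNorm P 2 Y < ENNReal.ofReal (2 * K) :=
    h.trans_lt ((ENNReal.ofReal_lt_ofReal_iff (by positivity)).2 (by linarith))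
  unfold orliczNorm at h1
  simp only [iInf_lt_iff] at h1
  obtain ⟨c, hc, hc2, hcK⟩ := h1
  rw [ENNReal.ofReal_lt_ofReal_iff (by positivity)] at hcK
  have hle : ∫⁻ ω, ENNReal.ofReal (Real.exp ((Y ω / (2 * K)) ^ 2)) ∂P ≤ 2 := by
    refine le_trans (lintegral_mono fun ω => ENNReal.ofReal_le_ofReal (Real.exp_le_exp.2 ?_)) hc2
    rw [Real.rpow_two, sq_abs, div_pow, div_pow]
    gcongr
  have hm : AEStronglyMeasurable (fun ω => Real.exp ((Y ω / (2 * K)) ^ 2)) P := by fun_prop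
  have hint : Integrable (fun ω => Real.exp ((Y ω / (2 * K)) ^ 2)) P := by
    refine ⟨hm, ?_⟩
    rw [hasFiniteIntegral_iff_ofReal (ae_of_all _ fun ω => (Real.exp_pos _).le)]
    exact hle.trans_lt (by norm_num)
  refine ⟨hint, ?_⟩
  rw [integral_eq_lintegral_of_nonneg_ae (ae_of_all _ fun ω => (Real.exp_pos _).le) hm]
  exact ENNReal.toReal_le_of_le_ofReal (by norm_num) (by simpa using hle)

end Probability

/-! ### Isotropic sub-Gaussian vectors -/

section Whitened

variable {Ω : Type u} [MeasurableSpace Ω] {P : Measure Ω}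

/-- A centered isotropic random vector with sub-Gaussian marginals. -/
structure IsIsotropicSubGaussian (P : Measure Ω) {p : ℕ} (K : ℝ) (Y : Ω → Vec p) : Prop where
  measurable : Measurable Y
  mean_zero : ∀ j, ∫ ω, Y ω j ∂P = 0
  second_moment : ∀ j k, ∫ ω, Y ω j * Y ω k ∂P = (1 : Matrix (Fin p) (Fin p) ℝ) j k
  integrable_exp : ∀ x ∈ Metric.sphere (0 : Vec p) 1,
    Integrable (fun ω => Real.exp ((inner ℝ (Y ω) x / (2 * K)) ^ 2)) P
  integral_exp_le : ∀ x ∈ Metric.sphere (0 : Vec p) 1,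
    ∫ ω, Real.exp ((inner ℝ (Y ω) x / (2 * K)) ^ 2) ∂P ≤ 2

variable {p : ℕ} {K : ℝ} {Y : Ω → Vec p}

theorem IsIsotropicSubGaussian.memLp_coord (h : IsIsotropicSubGaussian P K Y) (hK : 0 < K)
    (j : Fin p) : MemLp (fun ω => Y ω j) 2 P := by
  have hm := h.measurable
  have hj : EuclideanSpace.single j (1 : ℝ) ∈ Metric.sphere (0 : Vec p) 1 := by simp
  have h1 := h.integrable_exp _ hj
  simp only [EuclideanSpace.inner_single_right, one_mul, conj_trivial] at h1
  have hmj : Measurable fun ω => Y ω j := by fun_prop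
  rw [memLp_two_iff_integrable_sq hmj.aestronglyMeasurable]
  refine (h1.const_mul ((2 * K) ^ 2)).mono' (hmj.pow_const 2).aestronglyMeasurable
    (ae_of_all _ fun ω => ?_)
  rw [Real.norm_eq_abs, abs_of_nonneg (sq_nonneg _)]
  have h2 := Real.add_one_le_exp ((Y ω j / (2 * K)) ^ 2)
  calc Y ω j ^ 2 = (2 * K) ^ 2 * (Y ω j / (2 * K)) ^ 2 := by field_simp
    _ ≤ _ := by gcongr; linarith

theorem IsIsotropicSubGaussian.integral_inner [IsProbabilityMeasure P]
    (h : IsIsotropicSubGaussian P K Y) (hK : 0 < K)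
    (w : Vec p) : ∫ ω, inner ℝ (Y ω) w ∂P = 0 := by
  have h1 : ∀ ω, (inner ℝ (Y ω) w : ℝ) = ∑ j, w j * Y ω j := fun ω => by
    rw [PiLp.inner_apply]; exact Finset.sum_congr rfl fun k _ => by simp
  simp only [h1]
  rw [integral_finsetSum _ fun j _ => ((h.memLp_coord hK j).integrable one_le_two).const_mul _]
  simp [integral_const_mul, h.mean_zero]

theorem IsIsotropicSubGaussian.integral_inner_sq (h : IsIsotropicSubGaussian P K Y) (hK : 0 < K)
    (w : Vec p) : ∫ ω, inner ℝ (Y ω) w ^ 2 ∂P = ‖w‖ ^ 2 := by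
  have h1 : ∀ ω, (inner ℝ (Y ω) w : ℝ) ^ 2 = ∑ j, ∑ k, w j * w k * (Y ω j * Y ω k) := fun ω => by
    rw [PiLp.inner_apply, sq, Finset.sum_mul_sum]
    exact Finset.sum_congr rfl fun j _ => Finset.sum_congr rfl fun k _ => by simp; ring
  have hi : ∀ j k, Integrable (fun ω => w j * w k * (Y ω j * Y ω k)) P := fun j k =>
    ((h.memLp_coord hK j).integrable_mul (h.memLp_coord hK k)).const_mul _
  simp only [h1]
  rw [integral_finsetSum _ fun j _ => integrable_finsetSum _ fun k _ => hi j k,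
    EuclideanSpace.real_norm_sq_eq]
  refine Finset.sum_congr rfl fun j _ => ?_
  rw [integral_finsetSum _ fun k _ => hi j k]
  simp [integral_const_mul, h.second_moment, Matrix.one_apply, sq]

variable [IsProbabilityMeasure P]

theorem IsIsotropicSubGaussian.exp_inner (h : IsIsotropicSubGaussian P K Y) (hK : 0 < K)
    {w : Vec p} {ρ : ℝ} (hρ : 0 < ρ) (hw : ‖w‖ ≤ ρ) :
    Integrable (fun ω => Real.exp ((inner ℝ (Y ω) w / (2 * K * ρ)) ^ 2)) P ∧
      ∫ ω, Real.exp ((inner ℝ (Y ω) w / (2 * K * ρ)) ^ 2) ∂P ≤ 2 := by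
  have hm := h.measurable
  rcases eq_or_ne w 0 with rfl | hw0
  · simp
  have hwn : 0 < ‖w‖ := norm_pos_iff.2 hw0
  have hx : ‖w‖⁻¹ • w ∈ Metric.sphere (0 : Vec p) 1 := by
    simp [norm_smul, hwn.ne']
  have hle : ∀ ω, Real.exp ((inner ℝ (Y ω) w / (2 * K * ρ)) ^ 2)
      ≤ Real.exp ((inner ℝ (Y ω) (‖w‖⁻¹ • w) / (2 * K)) ^ 2) := fun ω => by
    rw [inner_smul_right, Real.exp_le_exp, ← sq_abs, ← sq_abs (_ / (2 * K))]
    refine pow_le_pow_left₀ (abs_nonneg _) ?_ 2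
    rw [abs_div, abs_div, abs_of_pos (by positivity : 0 < 2 * K * ρ),
      abs_of_pos (by positivity : 0 < 2 * K), abs_mul, abs_of_pos (inv_pos.2 hwn),
      mul_comm (2 * K) ρ, ← div_div, div_eq_inv_mul _ ρ]
    gcongr
  have hint : Integrable (fun ω => Real.exp ((inner ℝ (Y ω) w / (2 * K * ρ)) ^ 2)) P := by
    refine (h.integrable_exp _ hx).mono' ?_ (ae_of_all _ fun ω => ?_)
    · have : Measurable fun ω => (inner ℝ (Y ω) w : ℝ) := by fun_prop
      exact (Real.measurable_exp.comp ((this.div_const _).pow_const 2)).aestronglyMeasurable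
    · rw [Real.norm_eq_abs, Real.abs_exp]; exact hle ω
  exact ⟨hint, (integral_mono hint (h.integrable_exp _ hx) hle).trans (h.integral_exp_le _ hx)⟩

/-- From |t| ≤ 1 + t², the exponential moment is at most 2e < 6. -/
theorem IsIsotropicSubGaussian.isCenteredSubexp_inner (h : IsIsotropicSubGaussian P K Y)
    (hK : 0 < K) {w : Vec p} {ρ : ℝ} (hρ : 0 < ρ) (hw : ‖w‖ ≤ ρ) :
    IsCenteredSubexp P 6 fun ω => inner ℝ (Y ω) w / (2 * K * ρ) := by
  have hm := h.measurable
  obtain ⟨h1, h2⟩ := h.exp_inner hK hρ hw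
  have hmw : Measurable fun ω => (inner ℝ (Y ω) w : ℝ) := by fun_prop
  have hmw' := hmw.div_const (2 * K * ρ)
  have hle : ∀ ω, Real.exp |inner ℝ (Y ω) w / (2 * K * ρ)|
      ≤ Real.exp 1 * Real.exp ((inner ℝ (Y ω) w / (2 * K * ρ)) ^ 2) := fun ω => by
    rw [← Real.exp_add, Real.exp_le_exp, ← sq_abs (_ / _)]
    nlinarith [sq_nonneg (|inner ℝ (Y ω) w / (2 * K * ρ)| - 1)]
  have hint : Integrable (fun ω => Real.exp |inner ℝ (Y ω) w / (2 * K * ρ)|) P := by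
    refine (h1.const_mul (Real.exp 1)).mono' ?_ (ae_of_all _ fun ω => ?_)
    · exact (Real.measurable_exp.comp hmw'.abs).aestronglyMeasurable
    · rw [Real.norm_eq_abs, Real.abs_exp]; exact hle ω
  refine ⟨hmw', ?_, hint, (integral_mono hint (h1.const_mul _) hle).trans ?_⟩
  · rw [integral_div, h.integral_inner hK, zero_div]
  · rw [integral_const_mul]
    nlinarith [Real.exp_one_lt_d9, Real.exp_pos 1]

/-- The subtracted mean is at most 1, because t² + 1 ≤ exp(t²) has integral at most 2. Centering
therefore costs only a factor e, and again 2e < 6. -/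
theorem IsIsotropicSubGaussian.isCenteredSubexp_inner_sq (h : IsIsotropicSubGaussian P K Y)
    (hK : 0 < K) {w : Vec p} {ρ : ℝ} (hρ : 0 < ρ) (hw : ‖w‖ ≤ ρ) :
    IsCenteredSubexp P 6 fun ω =>
      (inner ℝ (Y ω) w / (2 * K * ρ)) ^ 2 - ‖w‖ ^ 2 / (2 * K * ρ) ^ 2 := by
  have hm := h.measurable
  obtain ⟨h1, h2⟩ := h.exp_inner hK hρ hw
  have hmw : Measurable fun ω => (inner ℝ (Y ω) w : ℝ) := by fun_prop
  have hmw' := (hmw.div_const (2 * K * ρ)).pow_const 2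
  have hsq : Integrable (fun ω => (inner ℝ (Y ω) w / (2 * K * ρ)) ^ 2) P := by
    refine h1.mono' hmw'.aestronglyMeasurable (ae_of_all _ fun ω => ?_)
    rw [Real.norm_eq_abs, abs_of_nonneg (sq_nonneg _)]
    linarith [Real.add_one_le_exp ((inner ℝ (Y ω) w / (2 * K * ρ)) ^ 2)]
  have hE : ∫ ω, (inner ℝ (Y ω) w / (2 * K * ρ)) ^ 2 ∂P = ‖w‖ ^ 2 / (2 * K * ρ) ^ 2 := by
    simp only [div_pow]
    rw [integral_div, h.integral_inner_sq hK]
  have hE1 : ‖w‖ ^ 2 / (2 * K * ρ) ^ 2 ≤ 1 := by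
    have h3 : ∫ ω, ((inner ℝ (Y ω) w / (2 * K * ρ)) ^ 2 + 1) ∂P ≤ 2 :=
      (integral_mono (hsq.add (integrable_const 1)) h1
        fun ω => Real.add_one_le_exp _).trans h2
    rw [integral_add hsq (integrable_const 1), hE] at h3
    simp at h3
    linarith
  have hE0 : 0 ≤ ‖w‖ ^ 2 / (2 * K * ρ) ^ 2 := by positivity
  have hle : ∀ ω, Real.exp |(inner ℝ (Y ω) w / (2 * K * ρ)) ^ 2 - ‖w‖ ^ 2 / (2 * K * ρ) ^ 2|
      ≤ Real.exp 1 * Real.exp ((inner ℝ (Y ω) w / (2 * K * ρ)) ^ 2) := fun ω => by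
    rw [← Real.exp_add, Real.exp_le_exp, abs_le]
    constructor <;> linarith [sq_nonneg (inner ℝ (Y ω) w / (2 * K * ρ))]
  have hmU := hmw'.sub_const (‖w‖ ^ 2 / (2 * K * ρ) ^ 2)
  have hint : Integrable (fun ω =>
      Real.exp |(inner ℝ (Y ω) w / (2 * K * ρ)) ^ 2 - ‖w‖ ^ 2 / (2 * K * ρ) ^ 2|) P := by
    refine (h1.const_mul (Real.exp 1)).mono' ?_ (ae_of_all _ fun ω => ?_)
    · exact (Real.measurable_exp.comp hmU.abs).aestronglyMeasurable
    · rw [Real.norm_eq_abs, Real.abs_exp]; exact hle ω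
  refine ⟨hmU, ?_, hint, (integral_mono hint (h1.const_mul _) hle).trans ?_⟩
  · rw [integral_sub hsq (integrable_const _), hE]; simp
  · rw [integral_const_mul]
    nlinarith [Real.exp_one_lt_d9, Real.exp_pos 1]

/-- Uniform deviation of the empirical variances in finitely many directions. -/
theorem exists_bound_empirical_variance (hK : 0 < K) {n : ℕ} {Z : Fin n → Ω → Vec p}
    (hZ : ∀ i, IsIsotropicSubGaussian P K (Z i)) (hind : iIndepFun Z P) {ρ L : ℝ} (hρ : 0 < ρ)
    (V : Finset (Vec p)) (hVρ : ∀ w ∈ V, ‖w‖ ≤ ρ) (hV : (V.card : ℝ) ≤ Real.exp (n * L))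
    (hL1 : 1 ≤ n * L) (hL : L ≤ 1 / 4) :
    ∃ G : Ω → ℝ, Integrable G P ∧ (∀ ω, 0 < G ω) ∧
      (∀ w ∈ V, ∀ ω, ((n : ℝ)⁻¹ * ∑ i, inner ℝ (Z i ω) w ^ 2
        - ((n : ℝ)⁻¹ * ∑ i, inner ℝ (Z i ω) w) ^ 2 - ‖w‖ ^ 2) ^ 2 ≤ G ω) ∧
      ∫ ω, G ω ∂P ≤ 10 ^ 8 * (2 * K * ρ) ^ 4 * L := by
  have hn0 : (0 : ℝ) < n := by
    rcases Nat.eq_zero_or_pos n with h | h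
    · subst h; norm_num at hL1
    · exact_mod_cast h
  have hL0 : 0 < L := by
    by_contra! h
    nlinarith
  set τ := 2 * K * ρ with hτ
  have hτ0 : 0 < τ := by positivity
  -- The squared empirical mean is part of the deviation, which is itself squared: averages need
  -- fourth moments, centered squares only second moments.
  obtain ⟨G₁, hi₁, hp₁, hb₁, hG₁⟩ := exists_bound_max_average (P := P) V (C := 6) (by norm_num)
    (fun w i ω => inner ℝ (Z i ω) w / τ)
    (fun w hw i => (hZ i).isCenteredSubexp_inner hK hρ (hVρ w hw))
    (fun w _ => hind.comp (fun _ z => inner ℝ z w / τ) fun _ => by fun_prop)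
    hV hL1 hL (k := 4) (by norm_num)
  obtain ⟨G₂, hi₂, hp₂, hb₂, hG₂⟩ := exists_bound_max_average (P := P) V (C := 6) (by norm_num)
    (fun w i ω => (inner ℝ (Z i ω) w / τ) ^ 2 - ‖w‖ ^ 2 / τ ^ 2)
    (fun w hw i => (hZ i).isCenteredSubexp_inner_sq hK hρ (hVρ w hw))
    (fun w _ => hind.comp (fun _ z => (inner ℝ z w / τ) ^ 2 - ‖w‖ ^ 2 / τ ^ 2)
      fun _ => by fun_prop)
    hV hL1 hL (k := 2) (by norm_num)
  refine ⟨fun ω => 2 * τ ^ 4 * (G₁ ω + G₂ ω), (hi₁.add hi₂).const_mul _, fun ω => ?_,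
    fun w hw ω => ?_, ?_⟩
  · have := hp₁ ω
    have := hp₂ ω
    positivity
  · set s₁ := (n : ℝ)⁻¹ * ∑ i, inner ℝ (Z i ω) w with hs₁
    set s₂ := (n : ℝ)⁻¹ * ∑ i, inner ℝ (Z i ω) w ^ 2 with hs₂
    have e₁ : (n : ℝ)⁻¹ * ∑ i, inner ℝ (Z i ω) w / τ = s₁ / τ := by
      rw [← Finset.sum_div, hs₁]; ring
    have e₂ : (n : ℝ)⁻¹ * ∑ i, ((inner ℝ (Z i ω) w / τ) ^ 2 - ‖w‖ ^ 2 / τ ^ 2)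
        = (s₂ - ‖w‖ ^ 2) / τ ^ 2 := by
      simp only [div_pow]
      rw [Finset.sum_sub_distrib, ← Finset.sum_div, hs₂]
      simp only [Finset.sum_const, Finset.card_univ, Fintype.card_fin, nsmul_eq_mul]
      field_simp
    have b₁ := hb₁ w hw ω
    have b₂ := hb₂ w hw ω
    rw [e₁] at b₁
    rw [e₂, sq_abs] at b₂
    rw [show |s₁ / τ| ^ 4 = (s₁ ^ 2 / τ ^ 2) ^ 2 by
      rw [← div_pow, ← sq_abs (s₁ / τ)]; ring] at b₁
    have : (s₂ - s₁ ^ 2 - ‖w‖ ^ 2) ^ 2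
        = τ ^ 4 * ((s₂ - ‖w‖ ^ 2) / τ ^ 2 - s₁ ^ 2 / τ ^ 2) ^ 2 := by
      field_simp; ring
    rw [this]
    change _ ≤ 2 * τ ^ 4 * (G₁ ω + G₂ ω)
    rw [mul_comm 2, mul_assoc]
    gcongr
    nlinarith [sq_nonneg ((s₂ - ‖w‖ ^ 2) / τ ^ 2 + s₁ ^ 2 / τ ^ 2)]
  · rw [integral_const_mul, integral_add hi₁ hi₂]
    have e4 : √L ^ 4 = L ^ 2 := by
      rw [show √L ^ 4 = (√L ^ 2) ^ 2 by ring, Real.sq_sqrt hL0.le]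
    rw [e4] at hG₁
    rw [Real.sq_sqrt hL0.le] at hG₂
    norm_num [Nat.factorial] at hG₁ hG₂
    calc 2 * τ ^ 4 * (∫ ω, G₁ ω ∂P + ∫ ω, G₂ ω ∂P)
        ≤ 2 * τ ^ 4 * (46118792 * L ^ 2 + 4810 * L) := by gcongr
      _ ≤ 2 * τ ^ 4 * (5 * 10 ^ 7 * L) := by gcongr; nlinarith
      _ = _ := by ring

end Whitened

/-! ### The sample covariance in whitened coordinates -/

theorem quadForm_outer {p : ℕ} (x u : Vec p) : quadForm (outer x) u = inner ℝ x u ^ 2 := by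
  rw [quadForm_eq_inner, op_outer, inner_smul_right, real_inner_comm]; ring

theorem quadForm_sampleCov {n p : ℕ} (x : Fin n → Vec p) (u : Vec p) :
    quadForm (sampleCov x) u
      = (n : ℝ)⁻¹ * ∑ i, inner ℝ (x i) u ^ 2 - ((n : ℝ)⁻¹ * ∑ i, inner ℝ (x i) u) ^ 2 := by
  unfold sampleCov sampleMean
  rw [quadForm_sub, quadForm_outer, inner_smul_left, sum_inner]
  congr 1
  rw [quadForm_eq_inner, op, map_smul, map_sum, smul_apply, sum_apply, inner_smul_right, inner_sum]
  congr 1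
  refine Finset.sum_congr rfl fun i _ => ?_
  rw [← quadForm_outer, quadForm_eq_inner]

/-- An empirical variance is translation invariant, so m drops out; symmetry of B moves it onto the
direction u. -/
theorem quadForm_sampleCov_affine {n p : ℕ} (hn : 1 ≤ n) {B : Matrix (Fin p) (Fin p) ℝ}
    (hB : B.IsHermitian) {x z : Fin n → Vec p} {m : Vec p} (hx : ∀ i, x i = m + op B (z i))
    (u : Vec p) :
    quadForm (sampleCov x) u = (n : ℝ)⁻¹ * ∑ i, inner ℝ (z i) (op B u) ^ 2
      - ((n : ℝ)⁻¹ * ∑ i, inner ℝ (z i) (op B u)) ^ 2 := by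
  have hn0 : (n : ℝ) ≠ 0 := by positivity
  have h : ∀ i, (inner ℝ (x i) u : ℝ) = inner ℝ m u + inner ℝ (z i) (op B u) := fun i => by
    rw [hx, inner_add_left, op_symm hB]
  rw [quadForm_sampleCov]
  simp only [h, add_sq, Finset.sum_add_distrib, ← Finset.mul_sum]
  simp only [Finset.sum_const, Finset.card_univ, Fintype.card_fin, nsmul_eq_mul]
  field_simp
  ring

section Sqrt

open scoped MatrixOrder

theorem sqrt_isHermitian {p : ℕ} (A : Matrix (Fin p) (Fin p) ℝ) :
    (CFC.sqrt A).IsHermitian :=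
  (Matrix.nonneg_iff_posSemidef.1 (CFC.sqrt_nonneg A)).isHermitian

theorem norm_op_sqrt_sq {p : ℕ} {A : Matrix (Fin p) (Fin p) ℝ} (hA : A.PosSemidef) (u : Vec p) :
    ‖op (CFC.sqrt A) u‖ ^ 2 = quadForm A u := by
  rw [← real_inner_self_eq_norm_sq, ← op_symm (sqrt_isHermitian A), quadForm_eq_inner,
    show op (CFC.sqrt A) (op (CFC.sqrt A) u) = op (CFC.sqrt A * CFC.sqrt A) u by
      rw [op, op, map_mul]; rfl, CFC.sqrt_mul_sqrt_self A hA.nonneg]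

end Sqrt

/-! ### Uniform deviation of the sample covariance matrix -/

section Main

variable {Ω : Type u} [MeasurableSpace Ω] {P : Measure Ω} [IsProbabilityMeasure P]

open scoped MatrixOrder in
/-- Deviation of the sample covariance matrix, uniformly in finitely many directions. -/
theorem exists_bound_quadForm {K : ℝ} (hK : 0 < K) {n p : ℕ} (hn : 1 ≤ n) {lam₁ lam₂ L : ℝ}
    {Sig : Matrix (Fin p) (Fin p) ℝ} {θ₁ : Vec p} {X : Fin n → Ω → Vec p}
    (hspike : IsSpiked Sig lam₁ lam₂ θ₁) (hX : SubGaussianAssumption P X Sig K)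
    (V : Finset (Vec p)) (hV1 : ∀ v ∈ V, ‖v‖ ≤ 1) (hV : (V.card : ℝ) ≤ Real.exp (n * L))
    (hL1 : 1 ≤ n * L) (hL : L ≤ 1 / 4) :
    ∃ G : Ω → ℝ, Integrable G P ∧ (∀ ω, 0 < G ω) ∧
      (∀ᵐ ω ∂P, ∀ v ∈ V, quadForm (sampleCov (fun i => X i ω) - Sig) v ^ 2 ≤ G ω) ∧
      ∫ ω, G ω ∂P ≤ 16 * 10 ^ 8 * K ^ 4 * lam₁ ^ 2 * L := by
  classical
  obtain ⟨Z, m, hiid, hmean, hcov, hXZ, horl⟩ := hX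
  have hlam : 0 < lam₁ := lt_of_le_of_lt hspike.1 hspike.2.1
  have hZ : ∀ i, IsIsotropicSubGaussian P K (Z i) := fun i => by
    have hm := hiid.measurable i
    have h : ∀ x ∈ Metric.sphere (0 : Vec p) 1,
        orliczNorm P 2 (fun ω => inner ℝ (Z i ω) x) ≤ ENNReal.ofReal K :=
      fun x hx => (le_iSup₂ (f := fun x (_ : x ∈ Metric.sphere (0 : Vec p) 1) =>
        orliczNorm P 2 (fun ω => inner ℝ (Z i ω) x)) x hx).trans (horl i)
    exact ⟨hm, hmean i, hcov i,
      fun x hx => (integrable_exp_of_orliczNorm_le hK (by fun_prop) (h x hx)).1,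
      fun x hx => (integrable_exp_of_orliczNorm_le hK (by fun_prop) (h x hx)).2⟩
  set B := CFC.sqrt Sig with hB
  have hBn : ∀ u, ‖op B u‖ ^ 2 = quadForm Sig u := norm_op_sqrt_sq hspike.posSemidef
  have hBle : ∀ v ∈ V, ‖op B v‖ ≤ √lam₁ := fun v hv => by
    refine Real.le_sqrt_of_sq_le ?_
    rw [hBn]
    refine (hspike.quadForm_le v).trans (mul_le_of_le_one_right hlam.le ?_)
    exact pow_le_one₀ (norm_nonneg _) (hV1 v hv)
  obtain ⟨G, hGi, hGp, hG, hGle⟩ := exists_bound_empirical_variance hK hZ hiid.indep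
    (Real.sqrt_pos.2 hlam) (V.image (op B))
    (fun w hw => by
      obtain ⟨v, hv, rfl⟩ := Finset.mem_image.1 hw
      exact hBle v hv)
    (le_trans (by exact_mod_cast Finset.card_image_le) hV) hL1 hL
  refine ⟨G, hGi, hGp, ?_, hGle.trans_eq ?_⟩
  · filter_upwards [ae_all_iff.2 hXZ] with ω hω v hv
    rw [quadForm_sub, quadForm_sampleCov_affine hn (sqrt_isHermitian Sig) hω, ← hBn]
    exact hG _ (Finset.mem_image_of_mem _ hv) ω
  · have : √lam₁ ^ 4 = lam₁ ^ 2 := by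
      rw [show √lam₁ ^ 4 = (√lam₁ ^ 2) ^ 2 by ring, Real.sq_sqrt hlam.le]
    rw [mul_pow, mul_pow, this]; ring

/-- Deviation of the sample covariance matrix, uniformly over the intersection of an `ℓ₁` and an
`ℓ₂` ball. -/
theorem exists_bound_bilinear {K : ℝ} (hK : 0 < K) {n p s : ℕ} (hn : 1 ≤ n) {lam₁ lam₂ r : ℝ}
    {Sig : Matrix (Fin p) (Fin p) ℝ} {θ₁ : Vec p} {X : Fin n → Ω → Vec p}
    (hspike : IsSpiked Sig lam₁ lam₂ θ₁) (hX : SubGaussianAssumption P X Sig K)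
    (hs1 : 1 ≤ s) (hs : s ≤ p) (hr : 0 ≤ r) (hrs : r ^ 2 ≤ 4 * s)
    (hL : s * Real.log (Real.exp 1 * p / s) / n ≤ 1 / 28) :
    ∃ G : Ω → ℝ, Integrable G P ∧ (∀ ω, 0 < G ω) ∧
      (∀ᵐ ω ∂P, ∀ x y : Vec p, ‖x‖ ≤ 1 → ∑ j, |x j| ≤ r → ‖y‖ ≤ 1 → ∑ j, |y j| ≤ r →
        inner ℝ x (op (sampleCov (fun i => X i ω) - Sig) y) ≤ √(G ω)) ∧
      ∫ ω, G ω ∂P ≤ 10 ^ 14 * K ^ 4 * lam₁ ^ 2 * (s * Real.log (Real.exp 1 * p / s) / n) := by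
  classical
  have hn0 : (0 : ℝ) < n := by exact_mod_cast hn
  obtain ⟨N, hNc, hN1, hN⟩ := exists_finset_dominating hs hr hrs
  set ℓ := s * Real.log (Real.exp 1 * p / s) with hℓ
  have hℓ1 : 1 ≤ ℓ := by
    have hs0 : (1 : ℝ) ≤ s := by exact_mod_cast hs1
    have hsp : (s : ℝ) ≤ p := by exact_mod_cast hs
    have h1 : 1 ≤ Real.log (Real.exp 1 * p / s) := by
      rw [Real.le_log_iff_exp_le (by have : (0 : ℝ) < p := by linarith
                                     positivity), le_div_iff₀ (by linarith)]
      gcongr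
    rw [hℓ]; nlinarith
  -- By polarization the bilinear form on N × N is a difference of quadratic forms at half sums and
  -- half differences, which remain in the unit ball.
  set V := (N ×ˢ N).image (fun q => (1 / 2 : ℝ) • (q.1 + q.2))
    ∪ (N ×ˢ N).image (fun q => (1 / 2 : ℝ) • (q.1 - q.2)) with hVdef
  have hV1 : ∀ v ∈ V, ‖v‖ ≤ 1 := by
    intro v hv
    rcases Finset.mem_union.1 hv with hv | hv <;> obtain ⟨⟨a, b⟩, hab, rfl⟩ := Finset.mem_image.1 hv
    all_goals
      have ha := hN1 a (Finset.mem_product.1 hab).1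
      have hb := hN1 b (Finset.mem_product.1 hab).2
      rw [norm_smul]
      norm_num
    · linarith [norm_add_le a b]
    · linarith [norm_sub_le a b]
  have hnL : (n : ℝ) * (7 * (ℓ / n)) = 7 * ℓ := by field_simp
  have hVc : (V.card : ℝ) ≤ Real.exp (n * (7 * (ℓ / n))) := by
    rw [hnL]
    refine le_trans ?_ (choose_mul_five_pow_le hs1 hs)
    have h1 : V.card ≤ 2 * (p.choose s * 5 ^ s) ^ 2 := by
      calc V.card ≤ (N ×ˢ N).card + (N ×ˢ N).card :=
            (Finset.card_union_le _ _).trans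
              (add_le_add Finset.card_image_le Finset.card_image_le)
        _ = 2 * N.card ^ 2 := by rw [Finset.card_product]; ring
        _ ≤ _ := by gcongr
    exact_mod_cast h1
  -- Here L = 7ℓ/n, so the threshold 1/28 is exactly the requirement L ≤ 1/4.
  obtain ⟨G, hGi, hGp, hG, hGle⟩ := exists_bound_quadForm hK hn hspike hX V hV1 hVc
    (by rw [hnL]; linarith) (by linarith)
  refine ⟨fun ω => 72 ^ 2 * G ω, hGi.const_mul _, fun ω => by have := hGp ω; positivity, ?_, ?_⟩
  · filter_upwards [hG] with ω hω x y hx hx1 hy hy1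
    have hA : (sampleCov (fun i => X i ω) - Sig).IsHermitian :=
      (sampleCov_isHermitian _).sub hspike.isHermitian
    have hab : ∀ v ∈ V, |quadForm (sampleCov (fun i => X i ω) - Sig) v| ≤ √(G ω) :=
      fun v hv => Real.abs_le_sqrt (hω v hv)
    -- Polarization costs 2 and domination in both arguments costs 36; this is the 72 in the
    -- rescaled G.
    have h1 := inner_op_le_of_dominating hA hN (B := 2 * √(G ω)) (fun v hv w hw => by
      rw [inner_op_eq_quadForm_sub hA]
      have hm : (v, w) ∈ N ×ˢ N := Finset.mem_product.2 ⟨hv, hw⟩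
      have h1 := hab ((1 / 2 : ℝ) • (v + w)) (Finset.mem_union_left _
        (Finset.mem_image_of_mem (fun q : Vec p × Vec p => (1 / 2 : ℝ) • (q.1 + q.2)) hm))
      have h2 := hab ((1 / 2 : ℝ) • (v - w)) (Finset.mem_union_right _
        (Finset.mem_image_of_mem (fun q : Vec p × Vec p => (1 / 2 : ℝ) • (q.1 - q.2)) hm))
      linarith [(abs_le.1 h1).2, (abs_le.1 h2).1]) hx hx1 hy hy1
    rw [Real.sqrt_mul (by norm_num), Real.sqrt_sq (by norm_num)]
    linarith
  · rw [integral_const_mul]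
    have : 0 ≤ K ^ 4 * lam₁ ^ 2 * (ℓ / n) := by positivity
    nlinarith

end Main

/-! ### From a bilinear noise bound to the projector error -/

/-- The bilinear form of `A` is at most `M` on the unit vectors of `ℓ₁`-norm at most `r`. -/
def BilinearBound {p : ℕ} (A : Matrix (Fin p) (Fin p) ℝ) (r M : ℝ) : Prop :=
  ∀ x y : Vec p, ‖x‖ ≤ 1 → ∑ j, |x j| ≤ r → ‖y‖ ≤ 1 → ∑ j, |y j| ≤ r → inner ℝ x (op A y) ≤ M

theorem sum_abs_le_sqrt_of_support {p : ℕ} {x : Vec p} {D : ℝ}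
    (h : ((Finset.univ.filter fun j => x j ≠ 0).card : ℝ) ≤ D) :
    ∑ j, |x j| ≤ √D * ‖x‖ := by
  have h0 : ∑ j, |x j| = ∑ j ∈ Finset.univ.filter (fun j => x j ≠ 0), |x j| := by
    rw [Finset.sum_filter_of_ne]
    intro j _ hj h
    simp [h] at hj
  have hD : 0 ≤ D := le_trans (Nat.cast_nonneg _) h
  rw [h0]
  refine le_of_sq_le_sq (sq_sum_le_card_mul_sum_sq.trans ?_) (by positivity)
  rw [mul_pow, Real.sq_sqrt hD, EuclideanSpace.real_norm_sq_eq]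
  simp only [sq_abs]
  refine mul_le_mul h (Finset.sum_le_sum_of_subset_of_nonneg (Finset.filter_subset _ _)
    fun _ _ _ => sq_nonneg _) (Finset.sum_nonneg fun _ _ => sq_nonneg _) hD

theorem mem_lqBall_zero {p : ℕ} {R : ℝ} {θ : Vec p} (h : θ ∈ lqBall 0 p R) :
    ((Finset.univ.filter fun j => θ j ≠ 0).card : ℝ) ≤ R := by
  have h' : (∑ j, if θ j ≠ 0 then (1 : ℝ) else 0) ≤ R := by simpa [lqBall] using h
  rwa [Finset.sum_boole] at h'

theorem mem_lqBall_pos {p : ℕ} {q R : ℝ} (hq : 0 < q) {θ : Vec p} (h : θ ∈ lqBall q p R) :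
    ∑ j, |θ j| ^ q ≤ R := by
  simpa [lqBall, hq.ne'] using h

theorem BilinearBound.inner_le {p : ℕ} {A : Matrix (Fin p) (Fin p) ℝ} {r M : ℝ}
    (h : BilinearBound A r M) {x y : Vec p} (hx : ∑ j, |x j| ≤ r * ‖x‖)
    (hy : ∑ j, |y j| ≤ r * ‖y‖) : inner ℝ x (op A y) ≤ ‖x‖ * ‖y‖ * M := by
  rcases eq_or_ne x 0 with rfl | hx0
  · simp
  rcases eq_or_ne y 0 with rfl | hy0
  · simp
  have aux : ∀ z : Vec p, z ≠ 0 → ∑ j, |z j| ≤ r * ‖z‖ →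
      ‖‖z‖⁻¹ • z‖ ≤ 1 ∧ ∑ j, |(‖z‖⁻¹ • z) j| ≤ r := by
    intro z hz hzr
    have hz' : 0 < ‖z‖ := norm_pos_iff.2 hz
    refine ⟨by rw [norm_smul, norm_inv, norm_norm]; exact inv_mul_le_one, ?_⟩
    simp only [PiLp.smul_apply, smul_eq_mul, abs_mul, abs_inv, abs_norm]
    rw [← Finset.mul_sum, inv_mul_le_iff₀ hz', mul_comm]
    exact hzr
  have h1 := h _ _ (aux x hx0 hx).1 (aux x hx0 hx).2 (aux y hy0 hy).1 (aux y hy0 hy).2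
  rw [map_smul, inner_smul_right, inner_smul_left] at h1
  have hxn : 0 < ‖x‖ := norm_pos_iff.2 hx0
  have hyn : 0 < ‖y‖ := norm_pos_iff.2 hy0
  simp only [conj_trivial] at h1
  calc inner ℝ x (op A y) = ‖x‖ * ‖y‖ * (‖y‖⁻¹ * (‖x‖⁻¹ * inner ℝ x (op A y))) := by
        field_simp
    _ ≤ _ := by gcongr

section Deterministic

variable {p : ℕ} {Sig S : Matrix (Fin p) (Fin p) ℝ} {lam₁ lam₂ R M : ℝ} {θ₁ b : Vec p}

/-- Both b - θ₁ and b + θ₁ have at most 2R nonzero entries. With w = ‖b-θ₁‖‖b+θ₁‖, so that ε² =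
w²/2, curvature reads (λ₁-λ₂)w²/4 ≤ wM, and one factor w cancels. -/
theorem IsSpiked.error_le_of_sparse (h : IsSpiked Sig lam₁ lam₂ θ₁) (hSh : S.IsHermitian)
    (hb : ‖b‖ = 1) (hS : quadForm S θ₁ ≤ quadForm S b) (hθR : θ₁ ∈ lqBall 0 p R)
    (hbR : b ∈ lqBall 0 p R) (hM : BilinearBound (S - Sig) √(2 * R) M) :
    frobNorm (outer b - outer θ₁) ^ 2 ≤ 8 / (lam₁ - lam₂) ^ 2 * M ^ 2 := by
  have hδ : 0 < lam₁ - lam₂ := sub_pos.2 h.2.1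
  have hθ1 : ‖θ₁‖ = 1 := by simpa using h.2.2.1
  have hcard : ∀ x : Vec p, (∀ j, x j ≠ 0 → b j ≠ 0 ∨ θ₁ j ≠ 0) →
      ((Finset.univ.filter fun j => x j ≠ 0).card : ℝ) ≤ 2 * R := by
    intro x hx
    have h1 : (Finset.univ.filter fun j => x j ≠ 0) ⊆
        (Finset.univ.filter fun j => b j ≠ 0) ∪ (Finset.univ.filter fun j => θ₁ j ≠ 0) := by
      intro j hj
      simpa using hx j (by simpa using hj)
    have h2 := (Finset.card_le_card h1).trans (Finset.card_union_le _ _)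
    have h3 : ((Finset.univ.filter fun j => x j ≠ 0).card : ℝ) ≤
      (Finset.univ.filter fun j => b j ≠ 0).card + (Finset.univ.filter fun j => θ₁ j ≠ 0).card := by
      exact_mod_cast h2
    linarith [mem_lqBall_zero hθR, mem_lqBall_zero hbR]
  have h1 := hM.inner_le (x := b - θ₁) (y := b + θ₁)
    (sum_abs_le_sqrt_of_support (hcard _ fun j hj => by
      by_contra! hc; exact hj (by simp [hc.1, hc.2])))
    (sum_abs_le_sqrt_of_support (hcard _ fun j hj => by
      by_contra! hc; exact hj (by simp [hc.1, hc.2])))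
  have h2 := h.curvature hb hS
  rw [quadForm_sub_quadForm (hSh.sub h.isHermitian)] at h2
  have h3 := norm_sub_mul_norm_add_sq hb hθ1
  set w := ‖b - θ₁‖ * ‖b + θ₁‖ with hw
  have hw0 : 0 ≤ w := by positivity
  have h4 : (lam₁ - lam₂) * w ≤ 4 * M := by
    rcases hw0.eq_or_lt with h0 | h0
    · have hM0 : 0 ≤ M := by
        have := hM 0 0 (by simp) (by simp) (by simp) (by simp)
        simpa using this
      rw [← h0]; linarith
    · refine le_of_mul_le_mul_right ?_ h0
      nlinarith
  have h5 : ((lam₁ - lam₂) * w) ^ 2 ≤ (4 * M) ^ 2 := pow_le_pow_left₀ (by positivity) h4 2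
  rw [div_mul_eq_mul_div, le_div_iff₀ (by positivity)]
  rw [mul_pow, h3] at h5
  linarith

theorem IsSpiked.error_le_of_l1 (h : IsSpiked Sig lam₁ lam₂ θ₁)
    (hb : ‖b‖ = 1) (hS : quadForm S θ₁ ≤ quadForm S b) (hθR : θ₁ ∈ lqBall 1 p R)
    (hbR : b ∈ lqBall 1 p R) (hM : BilinearBound (S - Sig) R M) :
    frobNorm (outer b - outer θ₁) ^ 2 ≤ 4 / (lam₁ - lam₂) * M := by
  have hδ : 0 < lam₁ - lam₂ := sub_pos.2 h.2.1
  have hθ1 : ‖θ₁‖ = 1 := by simpa using h.2.2.1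
  have hθR' : ∑ j, |θ₁ j| ≤ R := by simpa using mem_lqBall_pos one_pos hθR
  have hbR' : ∑ j, |b j| ≤ R := by simpa using mem_lqBall_pos one_pos hbR
  have h1 := hM b b hb.le hbR' hb.le hbR'
  have h2 := hM (-θ₁) θ₁ (by simp [hθ1]) (by simpa using hθR') hθ1.le hθR'
  have h3 := h.curvature hb hS
  rw [quadForm_eq_inner, quadForm_eq_inner] at h3
  rw [inner_neg_left] at h2
  rw [div_mul_eq_mul_div, le_div_iff₀ hδ]
  linarith

/-- Thresholding at 4t: for |d i| ≥ 4t, 2t|d i| is at most half of d i ² and is absorbed on the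
left; otherwise |d i| ≤ 4t^(1-q)|d i|^q, which the ℓ_q budget controls. -/
theorem sum_sq_le_of_sum_abs_rpow_le {ι : Type*} (s : Finset ι) (d : ι → ℝ) {q t ρ : ℝ}
    (hq : 0 < q) (hq1 : q < 1) (ht : 0 < t) (hρ : ∑ i ∈ s, |d i| ^ q ≤ ρ)
    (h : ∑ i ∈ s, d i ^ 2 ≤ 2 * t * ∑ i ∈ s, |d i|) :
    ∑ i ∈ s, d i ^ 2 ≤ 16 * ρ * t ^ (2 - q) := by
  have key : ∀ x : ℝ, 0 ≤ x → 2 * t * x ≤ 1 / 2 * x ^ 2 + 8 * t ^ (2 - q) * x ^ q := by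
    intro x hx
    rcases le_total (4 * t) x with h1 | h1
    · have : 0 ≤ 8 * t ^ (2 - q) * x ^ q := by positivity
      nlinarith
    · have e1 : x = x ^ (1 - q) * x ^ q := by
        rcases hx.eq_or_lt with rfl | hx
        · rw [Real.zero_rpow hq.ne', mul_zero]
        · rw [← Real.rpow_add hx]; simp
      have e2 : x ^ (1 - q) ≤ 4 * t ^ (1 - q) := by
        calc x ^ (1 - q) ≤ (4 * t) ^ (1 - q) := by gcongr
          _ = 4 ^ (1 - q) * t ^ (1 - q) := Real.mul_rpow (by norm_num) ht.le
          _ ≤ 4 * t ^ (1 - q) := by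
            gcongr
            calc (4 : ℝ) ^ (1 - q) ≤ 4 ^ (1 : ℝ) :=
                  Real.rpow_le_rpow_of_exponent_le (by norm_num) (by linarith)
              _ = 4 := Real.rpow_one 4
      have e3 : t ^ (2 - q) = t * t ^ (1 - q) := by
        rw [show 2 - q = 1 + (1 - q) by ring, Real.rpow_add ht, Real.rpow_one]
      calc 2 * t * x = 2 * t * (x ^ (1 - q) * x ^ q) := by rw [← e1]
        _ ≤ 2 * t * (4 * t ^ (1 - q) * x ^ q) := by gcongr
        _ = 8 * t ^ (2 - q) * x ^ q := by rw [e3]; ring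
        _ ≤ _ := by linarith [sq_nonneg x]
  have h1 : 2 * t * ∑ i ∈ s, |d i|
      ≤ 1 / 2 * ∑ i ∈ s, d i ^ 2 + 8 * t ^ (2 - q) * ∑ i ∈ s, |d i| ^ q := by
    rw [Finset.mul_sum, Finset.mul_sum, Finset.mul_sum, ← Finset.sum_add_distrib]
    refine Finset.sum_le_sum fun i _ => ?_
    have := key |d i| (abs_nonneg _)
    rwa [sq_abs] at this
  have h2 : 8 * t ^ (2 - q) * ∑ i ∈ s, |d i| ^ q ≤ 8 * t ^ (2 - q) * ρ := by gcongr
  linarith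

theorem quadForm_sub_eq_sum (A : Matrix (Fin p) (Fin p) ℝ) (a c : Vec p) :
    quadForm A a - quadForm A c
      = ∑ i ∈ Finset.univ ×ˢ Finset.univ, A i.1 i.2 * (outer a - outer c) i.1 i.2 := by
  rw [Finset.sum_product]
  simp only [quadForm, ← Finset.sum_sub_distrib]
  refine Finset.sum_congr rfl fun j _ => Finset.sum_congr rfl fun k _ => ?_
  simp only [outer, Matrix.sub_apply, Matrix.of_apply]; ring

/-- Coordinate vectors have ℓ₁-norm 1, so M bounds every entry of the noise. The ℓ_q sum of an outer
product is the square of that of the vector, and subadditivity of x^q gives 2R² for the difference.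
-/
theorem IsSpiked.error_le_of_lq {q : ℝ} (hq : 0 < q) (hq1 : q < 1)
    (h : IsSpiked Sig lam₁ lam₂ θ₁)
    (hb : ‖b‖ = 1) (hS : quadForm S θ₁ ≤ quadForm S b) (hθR : θ₁ ∈ lqBall q p R)
    (hbR : b ∈ lqBall q p R) (hM0 : 0 < M) (hM : BilinearBound (S - Sig) 1 M) :
    frobNorm (outer b - outer θ₁) ^ 2 ≤ 32 * R ^ 2 * (M / (lam₁ - lam₂)) ^ (2 - q) := by
  have hδ : 0 < lam₁ - lam₂ := sub_pos.2 h.2.1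
  have hent : ∀ j k, |(S - Sig) j k| ≤ M := by
    have h1 : ∀ j k, (inner ℝ (EuclideanSpace.single j (1 : ℝ))
        (op (S - Sig) (EuclideanSpace.single k (1 : ℝ))) : ℝ) = (S - Sig) j k := by
      intro j k
      rw [EuclideanSpace.inner_single_left, Matrix.ofLp_toEuclideanCLM]
      simp
    have h2 : ∀ j : Fin p, ∑ i, |(EuclideanSpace.single j (1 : ℝ) : Vec p) i| ≤ 1 := by
      intro j
      simp [apply_ite]
    intro j k
    rw [abs_le]
    constructor
    · have := hM (-EuclideanSpace.single j (1 : ℝ)) (EuclideanSpace.single k (1 : ℝ))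
        (by simp) (by simpa using h2 j) (by simp) (h2 k)
      rw [inner_neg_left, h1] at this
      linarith
    · have := hM (EuclideanSpace.single j (1 : ℝ)) (EuclideanSpace.single k (1 : ℝ))
        (by simp) (h2 j) (by simp) (h2 k)
      rwa [h1] at this
  set Δ := outer b - outer θ₁ with hΔ
  have hfro : frobNorm Δ ^ 2 = ∑ i ∈ Finset.univ ×ˢ Finset.univ, Δ i.1 i.2 ^ 2 := by
    rw [frobNorm_sq, Finset.sum_product]
  have hcurv : frobNorm Δ ^ 2 ≤ 2 * (M / (lam₁ - lam₂)) *
      ∑ i ∈ Finset.univ ×ˢ Finset.univ, |Δ i.1 i.2| := by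
    have h1 := h.curvature hb hS
    rw [quadForm_sub_eq_sum, ← hΔ] at h1
    have h2 : ∑ i ∈ Finset.univ ×ˢ Finset.univ, (S - Sig) i.1 i.2 * Δ i.1 i.2
        ≤ M * ∑ i ∈ Finset.univ ×ˢ Finset.univ, |Δ i.1 i.2| := by
      rw [Finset.mul_sum]
      refine Finset.sum_le_sum fun i _ => (le_abs_self _).trans ?_
      rw [abs_mul]
      gcongr
      exact hent _ _
    rw [show 2 * (M / (lam₁ - lam₂)) * ∑ i ∈ Finset.univ ×ˢ Finset.univ, |Δ i.1 i.2|
      = 2 * (M * ∑ i ∈ Finset.univ ×ˢ Finset.univ, |Δ i.1 i.2|) / (lam₁ - lam₂) by ring,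
      le_div_iff₀ hδ]
    linarith
  have hlq : ∑ i ∈ Finset.univ ×ˢ Finset.univ, |Δ i.1 i.2| ^ q ≤ 2 * R ^ 2 := by
    have hout : ∀ c : Vec p, c ∈ lqBall q p R →
        ∑ i ∈ Finset.univ ×ˢ Finset.univ, |outer c i.1 i.2| ^ q ≤ R ^ 2 := by
      intro c hc
      have h1 := mem_lqBall_pos hq hc
      have h2 : ∑ i ∈ Finset.univ ×ˢ Finset.univ, |outer c i.1 i.2| ^ q
          = (∑ j, |c j| ^ q) ^ 2 := by
        rw [Finset.sum_product, sq, Finset.sum_mul_sum]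
        refine Finset.sum_congr rfl fun j _ => Finset.sum_congr rfl fun k _ => ?_
        rw [outer, Matrix.of_apply, abs_mul, Real.mul_rpow (abs_nonneg _) (abs_nonneg _)]
      rw [h2]
      exact pow_le_pow_left₀ (Finset.sum_nonneg fun _ _ => by positivity) h1 2
    have h3 : ∀ i : Fin p × Fin p,
        |Δ i.1 i.2| ^ q ≤ |outer b i.1 i.2| ^ q + |outer θ₁ i.1 i.2| ^ q := by
      intro i
      calc |Δ i.1 i.2| ^ q ≤ (|outer b i.1 i.2| + |outer θ₁ i.1 i.2|) ^ q := by
            rw [hΔ, Matrix.sub_apply]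
            gcongr
            exact abs_sub _ _
        _ ≤ _ := Real.rpow_add_le_add_rpow (abs_nonneg _) (abs_nonneg _) hq.le hq1.le
    calc _ ≤ ∑ i ∈ Finset.univ ×ˢ Finset.univ,
          (|outer b i.1 i.2| ^ q + |outer θ₁ i.1 i.2| ^ q) := Finset.sum_le_sum fun i _ => h3 i
      _ ≤ 2 * R ^ 2 := by
        rw [Finset.sum_add_distrib]
        linarith [hout b hbR, hout θ₁ hθR]
  have := sum_sq_le_of_sum_abs_rpow_le _ (fun i : Fin p × Fin p => Δ i.1 i.2) hq hq1
    (div_pos hM0 hδ) hlq (by rw [← hfro]; exact hcurv)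
  rw [← hfro] at this
  linarith

end Deterministic

/-! ### Moment inequalities -/

section Moments

variable {Ω : Type u} [MeasurableSpace Ω] {P : Measure Ω} [IsProbabilityMeasure P]

/-- Jensen's inequality up to a factor 2, from x^a ≤ 1 + x at x = G/B. -/
theorem integral_rpow_le {G : Ω → ℝ} (hG : Integrable G P) (hG0 : ∀ ω, 0 < G ω) {a B : ℝ}
    (ha : 0 ≤ a) (ha1 : a ≤ 1) (hB : 0 < B) (hGB : ∫ ω, G ω ∂P ≤ B) :
    Integrable (fun ω => G ω ^ a) P ∧ ∫ ω, G ω ^ a ∂P ≤ 2 * B ^ a := by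
  have key : ∀ ω, G ω ^ a ≤ B ^ a * (1 + G ω / B) := by
    intro ω
    have hx := hG0 ω
    have : (G ω / B) ^ a ≤ 1 + G ω / B := by
      rcases le_total (G ω / B) 1 with h | h
      · exact (Real.rpow_le_one (by positivity) h ha).trans (by linarith [div_pos hx hB])
      · calc (G ω / B) ^ a ≤ (G ω / B) ^ (1 : ℝ) := Real.rpow_le_rpow_of_exponent_le h ha1
          _ = G ω / B := Real.rpow_one _
          _ ≤ _ := by linarith
    calc G ω ^ a = (B * (G ω / B)) ^ a := by rw [mul_div_cancel₀ _ hB.ne']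
      _ = B ^ a * (G ω / B) ^ a := Real.mul_rpow hB.le (by positivity)
      _ ≤ _ := by gcongr
  have hi : Integrable (fun ω => B ^ a * (1 + G ω / B)) P :=
    ((integrable_const 1).add (hG.div_const B)).const_mul _
  have hi2 : Integrable (fun ω => G ω ^ a) P := by
    refine hi.mono' (hG.aemeasurable.pow_const a).aestronglyMeasurable (ae_of_all _ fun ω => ?_)
    rw [Real.norm_eq_abs, abs_of_nonneg (Real.rpow_nonneg (hG0 ω).le a)]
    exact key ω
  refine ⟨hi2, (integral_mono hi2 hi key).trans ?_⟩
  rw [integral_const_mul, integral_add (integrable_const 1) (hG.div_const B), integral_div]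
  have : (∫ ω, G ω ∂P) / B ≤ 1 := (div_le_one hB).2 hGB
  simp only [integral_const, probReal_univ, smul_eq_mul, mul_one]
  nlinarith [Real.rpow_pos_of_pos hB a]

/-- Cauchy-Schwarz through f ≤ (f²/a + a)/2 with a = √B; this form asks for integrability of g only.
-/
theorem sq_integral_le_of_sq_le {f g : Ω → ℝ} (hf : ∀ ω, 0 ≤ f ω) (hg : Integrable g P)
    (hfg : ∀ᵐ ω ∂P, f ω ^ 2 ≤ g ω) {B : ℝ} (hB : 0 < B) (hgB : ∫ ω, g ω ∂P ≤ B) :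
    (∫ ω, f ω ∂P) ^ 2 ≤ B := by
  set a := √B with ha
  have ha0 : 0 < a := Real.sqrt_pos.2 hB
  have haa : a ^ 2 = B := Real.sq_sqrt hB.le
  have h1 : ∫ ω, f ω ∂P ≤ ∫ ω, (g ω / a + a) / 2 ∂P := by
    refine integral_mono_of_nonneg (ae_of_all _ hf)
      (((hg.div_const a).add (integrable_const a)).div_const 2) ?_
    filter_upwards [hfg] with ω hω
    rw [le_div_iff₀ two_pos]
    have : f ω ^ 2 / a ≤ g ω / a := by gcongr
    have h2 : f ω * 2 ≤ f ω ^ 2 / a + a := by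
      rw [div_add' _ _ _ ha0.ne', le_div_iff₀ ha0]
      nlinarith [sq_nonneg (f ω - a)]
    linarith
  rw [integral_div, integral_add (hg.div_const a) (integrable_const a), integral_div] at h1
  simp only [integral_const, probReal_univ, smul_eq_mul, one_mul] at h1
  have h2 : (∫ ω, g ω ∂P) / a ≤ a := by
    rw [div_le_iff₀ ha0, ← sq, haa]; exact hgB
  have h3 : ∫ ω, f ω ∂P ≤ a := by linarith
  rw [← haa]
  exact pow_le_pow_left₀ (integral_nonneg hf) h3 2

end Moments

/-! ### Consequences of the radius condition and effective dimensions -/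

/-- As Rbar ≥ 1, a positive power of p - 1 is at least e. Hence p - 1 ≥ 1, and raising the exponent
to 1 only enlarges the power. -/
theorem RadiusCondition.bounds {q lam₁ lam₂ Rbar α κ : ℝ} {n p : ℕ} (hp : 1 ≤ p) (hq : 0 ≤ q)
    (hq1 : q ≤ 1) (h : RadiusCondition q n p lam₁ lam₂ Rbar α κ) :
    1 ≤ Rbar ∧ Real.exp 1 ≤ (p : ℝ) - 1 ∧
      Real.exp 1 * Rbar ≤ ((p : ℝ) - 1) ^ (1 - q / 2) := by
  obtain ⟨-, h1, h2⟩ := h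
  have he : Real.exp 1 * Rbar ≤ ((p : ℝ) - 1) ^ (1 - q / 2) := by
    rwa [← div_eq_inv_mul, le_div_iff₀ (Real.exp_pos 1), mul_comm] at h2
  have hee : Real.exp 1 ≤ ((p : ℝ) - 1) ^ (1 - q / 2) :=
    le_trans (le_mul_of_one_le_right (Real.exp_pos 1).le h1) he
  have hp0 : (0 : ℝ) ≤ (p : ℝ) - 1 := by
    have : (1 : ℝ) ≤ p := by exact_mod_cast hp
    linarith
  have hgt : 1 ≤ (p : ℝ) - 1 := by
    by_contra! hlt
    have := Real.rpow_le_one hp0 hlt.le (by linarith : 0 ≤ 1 - q / 2)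
    linarith [Real.exp_one_gt_d9]
  refine ⟨h1, hee.trans ?_, he⟩
  calc ((p : ℝ) - 1) ^ (1 - q / 2) ≤ ((p : ℝ) - 1) ^ (1 : ℝ) :=
        Real.rpow_le_rpow_of_exponent_le hgt (by linarith)
    _ = _ := Real.rpow_one _

theorem le_mul_min_of {x y D c : ℝ} (hD : 0 ≤ D) (hc : D + 400 ≤ c) (hx : x ≤ 2) (hy : 0 ≤ y)
    (h : x ≤ D * y ∨ 1 / 200 ≤ y) : x ≤ c * min 1 y := by
  rw [mul_min_of_nonneg _ _ (by linarith : (0 : ℝ) ≤ c), le_min_iff]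
  refine ⟨by linarith, ?_⟩
  rcases h with h | h
  · exact h.trans (by gcongr; linarith)
  · nlinarith

/-- The effective dimension in the `ℓ₀` case. -/
theorem effective_dim_sparse {p : ℕ} {R : ℝ} (hR : 1 ≤ R - 1)
    (hRp : Real.exp 1 * (R - 1) ≤ (p : ℝ) - 1) :
    1 ≤ ⌊R⌋₊ ∧ ⌊R⌋₊ ≤ p ∧ 2 * R ≤ 4 * ⌊R⌋₊ ∧ 0 < Real.log (p / R) ∧
      ⌊R⌋₊ * Real.log (Real.exp 1 * p / ⌊R⌋₊) ≤ 7 * (R * Real.log (p / R)) := by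
  have he := Real.exp_one_gt_d9
  have hR0 : 0 < R := by linarith
  have hfl : (⌊R⌋₊ : ℝ) ≤ R := Nat.floor_le hR0.le
  have hfl2 : R < ⌊R⌋₊ + 1 := Nat.lt_floor_add_one R
  have hs1 : 1 ≤ ⌊R⌋₊ := Nat.le_floor (by simp; linarith)
  have hs0 : (1 : ℝ) ≤ ⌊R⌋₊ := by exact_mod_cast hs1
  have hs2 : R ≤ 2 * ⌊R⌋₊ := by linarith
  have hpR : Real.exp 1 * R ≤ 2 * p := by nlinarith
  have hp0 : (0 : ℝ) < p := by nlinarith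
  -- R ≤ 2(R-1) gives p/R ≥ e/2, and 1 - log 2 > 3/10. This lower bound is what lets 1 + log 2 be
  -- absorbed into 6 log(p/R).
  have hlog : 3 / 10 ≤ Real.log (p / R) := by
    have h1 : Real.log (Real.exp 1 / 2) ≤ Real.log (p / R) := by
      apply Real.log_le_log (by positivity)
      rw [div_le_div_iff₀ two_pos hR0]; linarith
    rw [Real.log_div (Real.exp_pos 1).ne' two_ne_zero, Real.log_exp] at h1
    linarith [Real.log_two_lt_d9]
  refine ⟨hs1, ?_, by linarith, by linarith, ?_⟩
  · have : (⌊R⌋₊ : ℝ) ≤ p := by nlinarith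
    exact_mod_cast this
  · have h1 : Real.log (Real.exp 1 * p / ⌊R⌋₊) ≤ 1 + Real.log 2 + Real.log (p / R) := by
      rw [← Real.log_exp 1, ← Real.log_mul (Real.exp_pos 1).ne' two_ne_zero,
        ← Real.log_mul (by positivity) (by positivity), Real.log_exp]
      apply Real.log_le_log (by positivity)
      rw [← mul_div_assoc, div_le_div_iff₀ (by positivity) hR0]
      have : 0 < Real.exp 1 * p := by positivity
      nlinarith
    have h2 : Real.log (Real.exp 1 * p / ⌊R⌋₊) ≤ 7 * Real.log (p / R) := by
      linarith [Real.log_two_lt_d9]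
    calc _ ≤ (⌊R⌋₊ : ℝ) * (7 * Real.log (p / R)) := by gcongr
      _ ≤ R * (7 * Real.log (p / R)) := by gcongr
      _ = _ := by ring

/-- The effective dimension in the `ℓ₁` case. -/
theorem effective_dim_l1 {p : ℕ} {R : ℝ} (hR : 1 ≤ R - 1) (hp : 1 ≤ p)
    (hRp : Real.exp 1 * (R - 1) ≤ √((p : ℝ) - 1)) :
    1 ≤ ⌈R ^ 2⌉₊ ∧ ⌈R ^ 2⌉₊ ≤ p ∧ R ^ 2 ≤ 4 * ⌈R ^ 2⌉₊ ∧ 0 < Real.log (p / R ^ 2) ∧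
      ⌈R ^ 2⌉₊ * Real.log (Real.exp 1 * p / ⌈R ^ 2⌉₊) ≤ 6 * (R ^ 2 * Real.log (p / R ^ 2)) := by
  have he := Real.exp_one_gt_d9
  have hR0 : 0 < R := by linarith
  have hp1 : (1 : ℝ) ≤ p := by exact_mod_cast hp
  have hsq : (Real.exp 1 * (R - 1)) ^ 2 ≤ (p : ℝ) - 1 := by
    rw [← Real.sq_sqrt (by linarith : 0 ≤ (p : ℝ) - 1)]
    exact pow_le_pow_left₀ (by positivity) hRp 2
  have hpR : Real.exp 1 ^ 2 * R ^ 2 ≤ 4 * p := by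
    have : R ^ 2 ≤ 4 * (R - 1) ^ 2 := by nlinarith
    rw [mul_pow] at hsq
    nlinarith [sq_nonneg (Real.exp 1)]
  have hp0 : (0 : ℝ) < p := by linarith
  have hc1 : R ^ 2 ≤ ⌈R ^ 2⌉₊ := Nat.le_ceil _
  have hc2 : (⌈R ^ 2⌉₊ : ℝ) < R ^ 2 + 1 := Nat.ceil_lt_add_one (sq_nonneg R)
  have hR2 : 4 ≤ R ^ 2 := by nlinarith
  -- As p/R² ≥ (e/2)², the logarithm is at least 2 - 2 log 2 > 6/10, so the extra 1 is at most 2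
  -- log(p/R²).
  have hlog : 6 / 10 ≤ Real.log (p / R ^ 2) := by
    have h1 : Real.log (Real.exp 1 ^ 2 / 2 ^ 2) ≤ Real.log (p / R ^ 2) := by
      apply Real.log_le_log (by positivity)
      rw [div_le_div_iff₀ (by norm_num) (by positivity)]; linarith
    rw [← div_pow, Real.log_pow, Real.log_div (Real.exp_pos 1).ne' two_ne_zero,
      Real.log_exp] at h1
    push_cast at h1
    linarith [Real.log_two_lt_d9]
  have hs0 : (0 : ℝ) < ⌈R ^ 2⌉₊ := by linarith
  refine ⟨Nat.one_le_ceil_iff.2 (by positivity), ?_, by linarith, by linarith, ?_⟩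
  · have h7 : 7 ≤ Real.exp 1 ^ 2 := by nlinarith
    refine Nat.ceil_le.2 ?_
    nlinarith
  · have h1 : Real.log (Real.exp 1 * p / ⌈R ^ 2⌉₊) ≤ 1 + Real.log (p / R ^ 2) := by
      rw [← Real.log_exp 1, ← Real.log_mul (by positivity) (by positivity), Real.log_exp]
      apply Real.log_le_log (by positivity)
      rw [← mul_div_assoc]
      gcongr
    have h2 : Real.log (Real.exp 1 * p / ⌈R ^ 2⌉₊) ≤ 3 * Real.log (p / R ^ 2) := by linarith
    calc _ ≤ (⌈R ^ 2⌉₊ : ℝ) * (3 * Real.log (p / R ^ 2)) := by gcongr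
      _ ≤ (2 * R ^ 2) * (3 * Real.log (p / R ^ 2)) := by gcongr; linarith
      _ = _ := by ring

/-! ### Risk bounds for the three ranges of q -/

section Risk

variable {Ω : Type u} [MeasurableSpace Ω] {P : Measure Ω} [IsProbabilityMeasure P]
  {K : ℝ} {n p : ℕ} {lam₁ lam₂ R : ℝ} {Sig : Matrix (Fin p) (Fin p) ℝ} {θ₁ : Vec p}
  {X : Fin n → Ω → Vec p} {θhat : Ω → Vec p}

theorem IsConstrainedPCA.spec {q : ℝ} {x : Fin n → Vec p} {b : Vec p}
    (h : IsConstrainedPCA q R x b) (hθ : ‖θ₁‖ = 1) (hθR : θ₁ ∈ lqBall q p R) :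
    ‖b‖ = 1 ∧ b ∈ lqBall q p R ∧ quadForm (sampleCov x) θ₁ ≤ quadForm (sampleCov x) b :=
  ⟨by simpa using h.1.1, h.1.2, h.2 (show θ₁ ∈ _ from ⟨by simpa using hθ, hθR⟩)⟩

theorem integral_sq_error_le_two {q : ℝ} (hθ : ‖θ₁‖ = 1) (hθR : θ₁ ∈ lqBall q p R)
    (hopt : ∀ᵐ ω ∂P, IsConstrainedPCA q R (fun i => X i ω) (θhat ω)) :
    ∫ ω, frobNorm (outer (θhat ω) - outer θ₁) ^ 2 ∂P ≤ 2 := by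
  have h : ∫ ω, frobNorm (outer (θhat ω) - outer θ₁) ^ 2 ∂P ≤ ∫ _ω, (2 : ℝ) ∂P := by
    refine integral_mono_of_nonneg (ae_of_all _ fun ω => sq_nonneg _) (integrable_const 2) ?_
    filter_upwards [hopt] with ω hω
    exact frobNorm_outer_sub_sq_le (hω.spec hθ hθR).1 hθ
  simpa using h

theorem sq_integral_error_le_two {q : ℝ} (hθ : ‖θ₁‖ = 1) (hθR : θ₁ ∈ lqBall q p R)
    (hopt : ∀ᵐ ω ∂P, IsConstrainedPCA q R (fun i => X i ω) (θhat ω)) :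
    (∫ ω, frobNorm (outer (θhat ω) - outer θ₁) ∂P) ^ 2 ≤ 2 := by
  refine sq_integral_le_of_sq_le (g := fun _ => 2) (fun ω => frobNorm_nonneg _)
    (integrable_const 2) ?_ two_pos (by simp)
  filter_upwards [hopt] with ω hω
  exact frobNorm_outer_sub_sq_le (hω.spec hθ hθR).1 hθ

theorem risk_sparse (hK : 0 < K) (hn : 1 ≤ n) (hspike : IsSpiked Sig lam₁ lam₂ θ₁)
    (hX : SubGaussianAssumption P X Sig K) (hθR : θ₁ ∈ lqBall 0 p R) (hR : 1 ≤ R - 1)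
    (hRp : Real.exp 1 * (R - 1) ≤ (p : ℝ) - 1)
    (hopt : ∀ᵐ ω ∂P, IsConstrainedPCA 0 R (fun i => X i ω) (θhat ω)) :
    (∫ ω, frobNorm (outer (θhat ω) - outer θ₁) ∂P) ^ 2
      ≤ 56 * (10 ^ 14 * K ^ 4)
        * (R * ((lam₁ / (lam₁ - lam₂)) ^ 2 / n) * Real.log (p / R)) ∨
    1 / 200 ≤ R * ((lam₁ / (lam₁ - lam₂)) ^ 2 / n) * Real.log (p / R) := by
  have hθ1 : ‖θ₁‖ = 1 := by simpa using hspike.2.2.1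
  have hn0 : (0 : ℝ) < n := by exact_mod_cast hn
  have hδ : 0 < lam₁ - lam₂ := sub_pos.2 hspike.2.1
  have hσ : 1 ≤ lam₁ / (lam₁ - lam₂) := by rw [le_div_iff₀ hδ]; linarith [hspike.1]
  set σt := lam₁ / (lam₁ - lam₂) with hσt
  obtain ⟨hs1, hsp, hRs, hlog, hdim⟩ := effective_dim_sparse hR hRp
  set ℓ := (⌊R⌋₊ : ℝ) * Real.log (Real.exp 1 * p / ⌊R⌋₊) with hℓ
  have hR0 : 0 < R := by linarith
  have hdimn : ℓ / n ≤ 7 * (R * Real.log (p / R) / n) := by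
    rw [← mul_div_assoc]; gcongr
  have hrhs : R * (σt ^ 2 / n) * Real.log (p / R) = σt ^ 2 * (R * Real.log (p / R) / n) := by
    ring
  have hy0 : 0 < R * Real.log (p / R) / n := by positivity
  rw [hrhs]
  rcases le_or_gt (ℓ / n) (1 / 28) with hL | hL
  · left
    obtain ⟨G, hGi, hGp, hG, hGle⟩ := exists_bound_bilinear hK hn hspike hX hs1 hsp
      (r := √(2 * R)) (Real.sqrt_nonneg _) (by rw [Real.sq_sqrt (by linarith)]; exact hRs) hL
    refine sq_integral_le_of_sq_le (g := fun ω => 8 / (lam₁ - lam₂) ^ 2 * G ω)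
      (fun ω => frobNorm_nonneg _) (hGi.const_mul _) ?_ (by positivity) ?_
    · filter_upwards [hG, hopt] with ω hω hω2
      obtain ⟨h1, h2, h3⟩ := hω2.spec hθ1 hθR
      have := hspike.error_le_of_sparse (sampleCov_isHermitian _) h1 h3 hθR h2 hω
      rwa [Real.sq_sqrt (hGp ω).le] at this
    · rw [integral_const_mul]
      calc 8 / (lam₁ - lam₂) ^ 2 * ∫ ω, G ω ∂P
          ≤ 8 / (lam₁ - lam₂) ^ 2 * (10 ^ 14 * K ^ 4 * lam₁ ^ 2
            * (7 * (R * Real.log (p / R) / n))) := by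
            gcongr
            exact hGle.trans (by gcongr)
        _ = _ := by rw [hσt, div_pow]; ring
  -- Here 1/28 < ℓ/n ≤ 7·R log(p/R)/n, so R log(p/R)/n exceeds 1/196, and σt ≥ 1.
  · right
    have : 1 ≤ σt ^ 2 := one_le_pow₀ hσ
    nlinarith

theorem risk_l1 (hK : 0 < K) (hn : 1 ≤ n) (hp : 1 ≤ p) (hspike : IsSpiked Sig lam₁ lam₂ θ₁)
    (hX : SubGaussianAssumption P X Sig K) (hθR : θ₁ ∈ lqBall 1 p R) (hR : 1 ≤ R - 1)
    (hRp : Real.exp 1 * (R - 1) ≤ √((p : ℝ) - 1))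
    (hopt : ∀ᵐ ω ∂P, IsConstrainedPCA 1 R (fun i => X i ω) (θhat ω)) :
    0 ≤ R * √((lam₁ / (lam₁ - lam₂)) ^ 2 / n * Real.log (p / R ^ 2)) ∧
    (∫ ω, frobNorm (outer (θhat ω) - outer θ₁) ^ 2 ∂P
      ≤ 8 * √(6 * (10 ^ 14 * K ^ 4))
        * (R * √((lam₁ / (lam₁ - lam₂)) ^ 2 / n * Real.log (p / R ^ 2))) ∨
    1 / 200 ≤ R * √((lam₁ / (lam₁ - lam₂)) ^ 2 / n * Real.log (p / R ^ 2))) := by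
  have hθ1 : ‖θ₁‖ = 1 := by simpa using hspike.2.2.1
  have hn0 : (0 : ℝ) < n := by exact_mod_cast hn
  have hδ : 0 < lam₁ - lam₂ := sub_pos.2 hspike.2.1
  have hlam : 0 < lam₁ := by linarith [hspike.1]
  have hσ : 1 ≤ lam₁ / (lam₁ - lam₂) := by rw [le_div_iff₀ hδ]; linarith [hspike.1]
  set σt := lam₁ / (lam₁ - lam₂) with hσt
  obtain ⟨hs1, hsp, hRs, hlog, hdim⟩ := effective_dim_l1 hR hp hRp
  set ℓ := (⌈R ^ 2⌉₊ : ℝ) * Real.log (Real.exp 1 * p / ⌈R ^ 2⌉₊) with hℓ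
  have hR0 : 0 < R := by linarith
  set y := R ^ 2 * Real.log (p / R ^ 2) / n with hy
  have hy0 : 0 < y := by positivity
  have hdimn : ℓ / n ≤ 6 * y := by
    rw [hy, ← mul_div_assoc]; gcongr
  have hrhs : R * √(σt ^ 2 / n * Real.log (p / R ^ 2)) = σt * √y := by
    rw [show σt ^ 2 / n * Real.log (p / R ^ 2) = (σt / R) ^ 2 * y by rw [hy]; field_simp,
      Real.sqrt_mul (sq_nonneg _), Real.sqrt_sq (by positivity)]
    field_simp
  rw [hrhs]
  refine ⟨by positivity, ?_⟩
  rcases le_or_gt (ℓ / n) (1 / 28) with hL | hL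
  · left
    obtain ⟨G, hGi, hGp, hG, hGle⟩ := exists_bound_bilinear hK hn hspike hX hs1 hsp
      (r := R) hR0.le hRs hL
    have hB : ∫ ω, G ω ∂P ≤ 10 ^ 14 * K ^ 4 * lam₁ ^ 2 * (6 * y) :=
      hGle.trans (by gcongr)
    obtain ⟨hi, hle⟩ := integral_rpow_le hGi hGp (a := 1 / 2) (by norm_num) (by norm_num)
      (by positivity) hB
    simp only [← Real.sqrt_eq_rpow] at hi hle
    calc ∫ ω, frobNorm (outer (θhat ω) - outer θ₁) ^ 2 ∂P
        ≤ ∫ ω, 4 / (lam₁ - lam₂) * √(G ω) ∂P := by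
          refine integral_mono_of_nonneg (ae_of_all _ fun ω => sq_nonneg _) (hi.const_mul _) ?_
          filter_upwards [hG, hopt] with ω hω hω2
          obtain ⟨h1, h2, h3⟩ := hω2.spec hθ1 hθR
          exact hspike.error_le_of_l1 h1 h3 hθR h2 hω
      _ ≤ 4 / (lam₁ - lam₂) * (2 * √(10 ^ 14 * K ^ 4 * lam₁ ^ 2 * (6 * y))) := by
          rw [integral_const_mul]; gcongr
      _ = _ := by
          rw [show 10 ^ 14 * K ^ 4 * lam₁ ^ 2 * (6 * y) = lam₁ ^ 2 * (6 * (10 ^ 14 * K ^ 4)) * y by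
            ring, Real.sqrt_mul (by positivity), Real.sqrt_mul (by positivity),
            Real.sqrt_sq hlam.le, hσt]
          ring
  · right
    have h1 : (1 / 200 : ℝ) ≤ √y := Real.le_sqrt_of_sq_le (by norm_num; linarith)
    exact h1.trans (le_mul_of_one_le_left (Real.sqrt_nonneg _) hσ)

theorem risk_lq {q : ℝ} (hq : 0 < q) (hq1 : q < 1) (hK : 0 < K) (hn : 1 ≤ n)
    (hspike : IsSpiked Sig lam₁ lam₂ θ₁)
    (hX : SubGaussianAssumption P X Sig K) (hθR : θ₁ ∈ lqBall q p R) (hR : 1 ≤ R - 1)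
    (hp : Real.exp 1 ≤ (p : ℝ) - 1)
    (hopt : ∀ᵐ ω ∂P, IsConstrainedPCA q R (fun i => X i ω) (θhat ω)) :
    0 ≤ R ^ 2 * ((lam₁ / (lam₁ - lam₂)) ^ 2 / n * Real.log p) ^ (1 - q / 2) ∧
    (∫ ω, frobNorm (outer (θhat ω) - outer θ₁) ^ 2 ∂P
      ≤ 64 * (1 + 2 * (10 ^ 14 * K ^ 4))
        * (R ^ 2 * ((lam₁ / (lam₁ - lam₂)) ^ 2 / n * Real.log p) ^ (1 - q / 2)) ∨
    1 / 200 ≤ R ^ 2 * ((lam₁ / (lam₁ - lam₂)) ^ 2 / n * Real.log p) ^ (1 - q / 2)) := by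
  have hθ1 : ‖θ₁‖ = 1 := by simpa using hspike.2.2.1
  have hn0 : (0 : ℝ) < n := by exact_mod_cast hn
  have hδ : 0 < lam₁ - lam₂ := sub_pos.2 hspike.2.1
  have hlam : 0 < lam₁ := by linarith [hspike.1]
  have hσ : 1 ≤ lam₁ / (lam₁ - lam₂) := by rw [le_div_iff₀ hδ]; linarith [hspike.1]
  set σt := lam₁ / (lam₁ - lam₂) with hσt
  have hp0 : (0 : ℝ) < p := by linarith [Real.exp_pos 1]
  have hp1 : 1 ≤ p := by exact_mod_cast hp0
  have hlog : 1 ≤ Real.log p := by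
    rw [Real.le_log_iff_exp_le hp0]; linarith
  set ℓ := ((1 : ℕ) : ℝ) * Real.log (Real.exp 1 * p / (1 : ℕ)) with hℓ
  have hdim : ℓ ≤ 2 * Real.log p := by
    rw [hℓ, Nat.cast_one, one_mul, div_one, Real.log_mul (Real.exp_pos 1).ne' hp0.ne',
      Real.log_exp]
    linarith
  set a := 1 - q / 2 with ha
  set y := σt ^ 2 / n * Real.log p with hy
  have hy0 : 0 < y := by positivity
  have hσ2 : 1 ≤ σt ^ 2 := one_le_pow₀ hσ
  refine ⟨by positivity, ?_⟩
  rcases le_or_gt (ℓ / n) (1 / 28) with hL | hL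
  · left
    -- Only entries of the noise are needed, so sparsity s = 1 suffices and the complexity is
    -- log(ep) ≤ 2 log p.
    obtain ⟨G, hGi, hGp, hG, hGle⟩ := exists_bound_bilinear hK hn hspike hX le_rfl hp1
      (r := 1) zero_le_one (by norm_num) hL
    set D := 10 ^ 14 * K ^ 4 with hD
    have hD0 : 0 < D := by positivity
    have hB : ∫ ω, G ω / (lam₁ - lam₂) ^ 2 ∂P ≤ 2 * D * y := by
      rw [integral_div, div_le_iff₀ (by positivity)]
      calc ∫ ω, G ω ∂P ≤ D * lam₁ ^ 2 * (2 * Real.log p / n) := hGle.trans (by gcongr)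
        _ = _ := by rw [hy, hσt]; field_simp
    obtain ⟨hi, hle⟩ := integral_rpow_le (hGi.div_const ((lam₁ - lam₂) ^ 2))
      (fun ω => div_pos (hGp ω) (by positivity)) (a := a) (by rw [ha]; linarith)
      (by rw [ha]; linarith) (by positivity) hB
    have hpow : (2 * D * y) ^ a ≤ (1 + 2 * D) * y ^ a := by
      rw [Real.mul_rpow (by positivity) hy0.le]
      gcongr
      calc (2 * D) ^ a ≤ (1 + 2 * D) ^ a := by
            gcongr
            · rw [ha]; linarith
            · linarith
        _ ≤ (1 + 2 * D) ^ (1 : ℝ) :=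
            Real.rpow_le_rpow_of_exponent_le (by linarith) (by rw [ha]; linarith)
        _ = _ := Real.rpow_one _
    calc ∫ ω, frobNorm (outer (θhat ω) - outer θ₁) ^ 2 ∂P
        ≤ ∫ ω, 32 * R ^ 2 * (G ω / (lam₁ - lam₂) ^ 2) ^ a ∂P := by
          refine integral_mono_of_nonneg (ae_of_all _ fun ω => sq_nonneg _) (hi.const_mul _) ?_
          filter_upwards [hG, hopt] with ω hω hω2
          obtain ⟨h1, h2, h3⟩ := hω2.spec hθ1 hθR
          have h4 := hspike.error_le_of_lq hq hq1 h1 h3 hθR h2 (Real.sqrt_pos.2 (hGp ω)) hω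
          have h5 : (√(G ω) / (lam₁ - lam₂)) ^ (2 - q) = (G ω / (lam₁ - lam₂) ^ 2) ^ a := by
            have h6 : G ω / (lam₁ - lam₂) ^ 2 = (√(G ω) / (lam₁ - lam₂)) ^ (2 : ℝ) := by
              rw [Real.rpow_two, div_pow, Real.sq_sqrt (hGp ω).le]
            rw [h6, ← Real.rpow_mul (by positivity), ha]
            congr 1; ring
          rwa [h5] at h4
      _ ≤ 32 * R ^ 2 * (2 * ((1 + 2 * D) * y ^ a)) := by
          rw [integral_const_mul]
          gcongr
          exact hle.trans (by gcongr)
      _ = _ := by ring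
  · right
    have h1 : 1 / 56 ≤ y := by
      have h2 : ℓ / n ≤ 2 * Real.log p / n := by gcongr
      have h3 : 1 * (Real.log p / n) ≤ σt ^ 2 * (Real.log p / n) := by gcongr
      have h4 : y = σt ^ 2 * (Real.log p / n) := by rw [hy]; ring
      have h5 : 2 * Real.log p / n = 2 * (Real.log p / n) := by ring
      linarith
    have h2 : (1 / 56 : ℝ) ≤ y ^ a := by
      calc (1 / 56 : ℝ) = (1 / 56) ^ (1 : ℝ) := (Real.rpow_one _).symm
        _ ≤ (1 / 56) ^ a := Real.rpow_le_rpow_of_exponent_ge (by norm_num) (by norm_num)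
            (by rw [ha]; linarith)
        _ ≤ y ^ a := by
          gcongr
          rw [ha]; linarith
    have h3 : 1 ≤ R ^ 2 := one_le_pow₀ (by linarith)
    nlinarith

end Risk

end SparsePCA

/-! ### Assembly -/

theorem theorem2 (K : ℝ) (hK : 0 < K) :
    ∃ c : ℝ, 0 < c ∧
      ∀ (Ω : Type u) [MeasurableSpace Ω] (P : Measure Ω) [IsProbabilityMeasure P]
        (n p : ℕ) (q lam₁ lam₂ R α κ : ℝ)
        (Sig : Matrix (Fin p) (Fin p) ℝ) (θ₁ : SparsePCA.Vec p)
        (X : Fin n → Ω → SparsePCA.Vec p) (θhat : Ω → SparsePCA.Vec p),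
        1 ≤ n → 0 ≤ q → q ≤ 1 → 0 < α → α ≤ 1 → 0 < κ →
        SparsePCA.InModelClass P X q lam₁ lam₂ (R - 1) α κ Sig θ₁ →
        SparsePCA.SubGaussianAssumption P X Sig K →
        Measurable θhat →
        (∀ᵐ ω ∂P, SparsePCA.IsConstrainedPCA q R (fun i => X i ω) (θhat ω)) →
        let ε : Ω → ℝ :=
          fun ω => SparsePCA.frobNorm (SparsePCA.outer (θhat ω) - SparsePCA.outer θ₁)
        let σt : ℝ := lam₁ / (lam₁ - lam₂)
        (0 < q → q < 1 →
          ∫ ω, ε ω ^ 2 ∂P ≤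
            c * min 1 (R ^ 2 * (σt ^ 2 / n * Real.log p) ^ (1 - q / 2))) ∧
        (q = 1 →
          ∫ ω, ε ω ^ 2 ∂P ≤
            c * min 1 (R * (σt ^ 2 / n * Real.log (p / R ^ 2)) ^ (1 / 2 : ℝ))) ∧
        (q = 0 →
          (∫ ω, ε ω ∂P) ^ 2 ≤
            c * min 1 (R * (σt ^ 2 / n) * Real.log (p / R))) := by
  set D := 10 ^ 14 * K ^ 4 with hD
  have hD0 : 0 < D := by positivity
  -- The sum of the three case constants, plus 400 for the regime where the rate is at least 1/200
  -- and only the trivial bound 2 is available.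
  refine ⟨400 + 64 * (1 + 2 * D) + 8 * √(6 * D) + 56 * D, by positivity, ?_⟩
  intro Ω _ P _ n p q lam₁ lam₂ R α κ Sig θ₁ X θhat hn hq hq1 hα hα1 hκ hmod hsub _ hopt ε σt
  have hspike := hmod.spiked
  have hθ1 : ‖θ₁‖ = 1 := by simpa using hspike.2.2.1
  have hθR : θ₁ ∈ SparsePCA.lqBall q p R := by simpa using hmod.mem_ball
  have hp : 1 ≤ p := by
    rcases Nat.eq_zero_or_pos p with h | h
    · subst h
      rw [Subsingleton.elim θ₁ 0, norm_zero] at hθ1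
      norm_num at hθ1
    · exact h
  obtain ⟨hR, hpe, hRp⟩ := hmod.radius.bounds hp hq hq1
  have hsq := Real.sqrt_nonneg (6 * D)
  refine ⟨fun h0 h1 => ?_, ?_, ?_⟩
  · obtain ⟨hy, h⟩ := SparsePCA.risk_lq h0 h1 hK hn hspike hsub hθR hR hpe hopt
    exact SparsePCA.le_mul_min_of (by positivity) (by linarith)
      (SparsePCA.integral_sq_error_le_two hθ1 hθR hopt) hy h
  · rintro rfl
    rw [show (1 - 1 / 2 : ℝ) = 1 / 2 by norm_num, ← Real.sqrt_eq_rpow] at hRp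
    obtain ⟨hy, h⟩ := SparsePCA.risk_l1 hK hn hp hspike hsub hθR hR hRp hopt
    rw [← Real.sqrt_eq_rpow]
    exact SparsePCA.le_mul_min_of (by positivity) (by linarith)
      (SparsePCA.integral_sq_error_le_two hθ1 hθR hopt) hy h
  · rintro rfl
    rw [zero_div, sub_zero, Real.rpow_one] at hRp
    have hlog := (SparsePCA.effective_dim_sparse hR hRp).2.2.2.1
    have hR0 : 0 < R := by linarith
    exact SparsePCA.le_mul_min_of (by positivity) (by linarith)
      (SparsePCA.sq_integral_error_le_two hθ1 hθR hopt) (by positivity)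
      (SparsePCA.risk_sparse hK hn hspike hsub hθR hR hRp hopt)
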